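/- Let $\mathbb{K}$ be a field of characteristic zero. View a permutation of size $n\ge 0$ as a word of length $n$ without repetition on the first $n$ letters of the ordered alphabet $a_1<a_2<\cdots$, and let $\mathfrak{S}$ be the set of permutations of all sizes. Let $\mathbf{FQSym}$ be the Malvenuto--Reutenauer Hopf algebra (free quasi-symmetric functions): the $\mathbb{K}$-vector space with basis $(\mathbf{F}_\sigma)_{\sigma\in\mathfrak{S}}$, with product $$\mathbf{F}_\sigma\cdot\mathbf{F}_\nu=\sum_{\pi}\mathbf{F}_\pi,$$ where $\pi$ runs over the shuffles of $\sigma$ with the word obtained from $\nu$ by shifting all its letters by the size of $\sigma$, and with coproduct $$\Delta(\mathbf{F}_\sigma)=\sum_{\sigma=uv}\mathbf{F}_{\operatorname{std}(u)}\otimes\mathbf{F}_{\operatorname{std}(v)},$$ where $\operatorname{std}(u)$, the standardization of $u$, is the permutation of size $|u|$ having the same inversions as $u$. The canopy of a (planar, rooted, possibly empty) binary tree is the $0/1$-word obtained by reading its leaves from left to right, except the first and the last one, and writing $0$ for a right-oriented leaf (one that is a right child) and $1$ for a left-oriented one. A pair of twin binary trees is a pair $(T_L,T_R)$ of binary trees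 with the same number of nodes whose canopies are complementary, i.e. differ at every position; let $\mathcal{TBT}$ be the set of all such pairs. For a permutation $\sigma$, let $\mathsf{P}(\sigma)$ be the pair of shapes (unlabeled trees) of the two binary search trees obtained by inserting the letters of $\sigma$ at the leaves, from left to right for the first tree, and from right to left for the second one. For $J\in\mathcal{TBT}$ set $$\mathbf{P}_J:=\sum_{\sigma\in\mathfrak{S},\ \mathsf{P}(\sigma)=J}\mathbf{F}_\sigma .$$ Then the linear span $\mathbf{Baxter}$ of the family $\{\mathbf{P}_J\}_{J\in\mathcal{TBT}}$ is a Hopf subalgebra of $\mathbf{FQSym}$: it contains the unit, is closed under the product, satisfies $\Delta(\mathbf{Baxter})\subseteq\mathbf{Baxter}\otimes\mathbf{Baxter}$, and is stable under the antipode. -/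

import Mathlib

namespace BaxterHopf

open scoped TensorProduct

/-! ### Words, shuffles, standardization -/

section Shuffle

variable {α : Type*}

/-- The shuffle product of two words, as a multiset of words. -/
def shuffle : List α → List α → Multiset (List α)
  | [], v => {v}
  | a :: u, [] => {a :: u}
  | a :: u, b :: v =>
    (shuffle u (b :: v)).map (List.cons a) + (shuffle (a :: u) v).map (List.cons b)
termination_by u v => u.length + v.length

theorem shuffle_nil_left (v : List α) : shuffle [] v = {v} := by
  rw [shuffle]

theorem shuffle_nil_right (u : List α) : shuffle u [] = {u} := by
  cases u <;> rw [shuffle]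

theorem shuffle_cons_cons (a b : α) (u v : List α) :
    shuffle (a :: u) (b :: v) =
      (shuffle u (b :: v)).map (List.cons a) + (shuffle (a :: u) v).map (List.cons b) := by
  rw [shuffle]

theorem perm_of_mem_shuffle (u v : List α) :
    ∀ w ∈ shuffle u v, w.Perm (u ++ v) := by
  induction u generalizing v with
  | nil => simp [shuffle_nil_left]
  | cons a u ihu =>
    induction v with
    | nil => simp [shuffle_nil_right]
    | cons b v ihv =>
      intro w hw
      rw [shuffle_cons_cons, Multiset.mem_add, Multiset.mem_map, Multiset.mem_map] at hw
      rcases hw with ⟨x, hx, rfl⟩ | ⟨x, hx, rfl⟩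
      · exact (ihu _ x hx).cons a
      · exact ((ihv x hx).cons b).trans List.perm_middle.symm

theorem shuffle_map {β : Type*} (f : α → β) (u v : List α) :
    shuffle (u.map f) (v.map f) = (shuffle u v).map (List.map f) := by
  induction u generalizing v with
  | nil => simp [shuffle_nil_left]
  | cons a u ihu =>
    induction v with
    | nil => simp [shuffle_nil_right]
    | cons b v ihv =>
      have h1 := ihu (b :: v)
      simp only [List.map_cons] at h1 ihv ⊢
      rw [shuffle_cons_cons, shuffle_cons_cons, h1, ihv]
      simp only [Multiset.map_add, Multiset.map_map]
      rfl

theorem bind_self_singleton (s : Multiset (List α)) : (s.bind fun a => {a}) = s := by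
  rw [Multiset.bind_singleton, Multiset.map_id']

theorem shuffle_assoc (u v w : List α) :
    ((shuffle u v).bind fun x => shuffle x w) = (shuffle v w).bind fun y => shuffle u y := by
  induction u generalizing v w with
  | nil => simp [shuffle_nil_left, Multiset.singleton_bind, bind_self_singleton]
  | cons a u ihu =>
    induction v generalizing w with
    | nil => simp [shuffle_nil_left, shuffle_nil_right]
    | cons b v ihv =>
      induction w with
      | nil => simp [shuffle_nil_right, bind_self_singleton]
      | cons c w ihw =>
        have h1 := ihu (b :: v) (c :: w)
        have h2 := ihv (c :: w)
        rw [shuffle_cons_cons, Multiset.add_bind, Multiset.bind_map, Multiset.bind_map] at ihw ⊢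
        simp only [shuffle_cons_cons, Multiset.bind_add, Multiset.add_bind, Multiset.bind_map,
          ← Multiset.map_bind] at h1 h2 ihw ⊢
        rw [← h2, ← ihw, h1]
        simp only [Multiset.map_add]
        abel

/-- The sum of `f x y` over all factorizations `w = x y` of a word. -/
def cutSum {M : Type*} [AddCommMonoid M] (f : List α → List α → M) (w : List α) : M :=
  ∑ i ∈ Finset.range (w.length + 1), f (w.take i) (w.drop i)

section Cut

variable {M : Type*} [AddCommMonoid M]

theorem cutSum_nil (f : List α → List α → M) : cutSum f [] = f [] [] := by
  simp [cutSum]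

theorem cutSum_cons (f : List α → List α → M) (a : α) (w : List α) :
    cutSum f (a :: w) = f [] (a :: w) + cutSum (fun x y => f (a :: x) y) w := by
  simp only [cutSum, List.length_cons]
  rw [Finset.sum_range_succ']
  simp [add_comm]

theorem cutSum_add (f g : List α → List α → M) (w : List α) :
    cutSum (fun x y => f x y + g x y) w = cutSum f w + cutSum g w := by
  simp [cutSum, Finset.sum_add_distrib]

theorem cutSum_cutSum (f : List α → List α → List α → M) (w : List α) :
    cutSum (fun x y => cutSum (fun x1 x2 => f x1 x2 y) x) w =
      cutSum (fun x y => cutSum (fun y1 y2 => f x y1 y2) y) w := by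
  induction w generalizing f with
  | nil => simp [cutSum_nil]
  | cons a w ih =>
    simp only [cutSum_cons, cutSum_nil, cutSum_add, ih]
    rw [add_assoc]

/-- The sum of `f x y` over all `x` in one shuffle and all `y` in another one. -/
def shufflePairSum (f : List α → List α → M) (u1 v1 u2 v2 : List α) : M :=
  ((shuffle u1 v1).map fun x => ((shuffle u2 v2).map fun y => f x y).sum).sum

theorem shuffle_cutSum (f : List α → List α → M) (u v : List α) :
    ((shuffle u v).map fun w => cutSum f w).sum =
      cutSum (fun u1 u2 => cutSum (fun v1 v2 => shufflePairSum f u1 v1 u2 v2) v) u := by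
  induction u generalizing v f with
  | nil => simp [shuffle_nil_left, cutSum_nil, shufflePairSum]
  | cons a u ihu =>
    induction v generalizing f with
    | nil => simp [shuffle_nil_right, cutSum_nil, shufflePairSum]
    | cons b v ihv =>
      have h1 := ihu (fun x y => f (a :: x) y) (b :: v)
      have h2 := ihv (fun x y => f (b :: x) y)
      have e1 : ∀ u1 u2 v2, shufflePairSum f (a :: u1) [] u2 v2 =
          shufflePairSum (fun x y => f (a :: x) y) u1 [] u2 v2 := by
        intro u1 u2 v2
        simp [shufflePairSum, shuffle_nil_right]
      have e2 : ∀ v1 u2 v2, shufflePairSum f [] (b :: v1) u2 v2 =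
          shufflePairSum (fun x y => f (b :: x) y) [] v1 u2 v2 := by
        intro u1 u2 v2
        simp [shufflePairSum, shuffle_nil_left]
      have e3 : ∀ u1 v1 u2 v2, shufflePairSum f (a :: u1) (b :: v1) u2 v2 =
          shufflePairSum (fun x y => f (a :: x) y) u1 (b :: v1) u2 v2 +
          shufflePairSum (fun x y => f (b :: x) y) (a :: u1) v1 u2 v2 := by
        intro u1 v1 u2 v2
        simp [shufflePairSum, shuffle_cons_cons, Multiset.map_map]
      have e4 : shufflePairSum f [] [] (a :: u) (b :: v) =
          ((shuffle u (b :: v)).map fun w => f [] (a :: w)).sum +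
          ((shuffle (a :: u) v).map fun w => f [] (b :: w)).sum := by
        simp [shufflePairSum, shuffle_nil_left, shuffle_cons_cons, Multiset.map_map]
      rw [shuffle_cons_cons, Multiset.map_add, Multiset.sum_add, Multiset.map_map,
        Multiset.map_map]
      simp only [Function.comp_def, cutSum_cons, Multiset.sum_map_add, e1, e2, e3, e4, cutSum_add]
        at h1 h2 ⊢
      rw [h1, h2]
      abel

end Cut

end Shuffle

section Std

/-- The standardization of a word *without repetition*: each letter is replaced by its rank,
that is by the number of smaller letters in the word. The result is the permutation of
`0, …, n - 1` having the same inversions. -/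
def std (u : List ℕ) : List ℕ := u.map fun x => u.countP (· < x)

theorem countP_lt_strictMono (u : List ℕ) {x y : ℕ} (hx : x ∈ u) (hxy : x < y) :
    u.countP (· < x) < u.countP (· < y) := by
  have key : ∀ l : List ℕ, l.countP (· < x) + l.countP (· = x) ≤ l.countP (· < y) := by
    intro l
    induction l with
    | nil => simp
    | cons a l ih =>
      simp only [List.countP_cons, decide_eq_true_eq]
      split_ifs <;> omega
  have h2 : 0 < u.countP (· = x) := List.countP_pos_iff.2 ⟨x, hx, by simp⟩
  have := key u
  omega

theorem std_perm {u : List ℕ} (hu : u.Nodup) : (std u).Perm (List.range (std u).length) := by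
  have hinj : ∀ x ∈ u, ∀ y ∈ u, u.countP (· < x) = u.countP (· < y) → x = y := by
    intro x hx y hy h
    rcases lt_trichotomy x y with hxy | hxy | hxy
    · have := countP_lt_strictMono u hx hxy
      omega
    · exact hxy
    · have := countP_lt_strictMono u hy hxy
      omega
  have hnd : (std u).Nodup := List.Nodup.map_on hinj hu
  refine List.perm_of_nodup_nodup_toFinset_eq hnd List.nodup_range ?_
  apply Finset.eq_of_subset_of_card_le
  · intro z hz
    simp only [std, List.mem_toFinset, List.mem_map] at hz
    obtain ⟨x, hx, rfl⟩ := hz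
    simp only [List.mem_toFinset, List.mem_range, std, List.length_map]
    calc u.countP (· < x) < u.countP (· < u.sum + 1) := by
          apply countP_lt_strictMono u hx
          have := List.single_le_sum (l := u) (by simp) x hx
          omega
      _ ≤ u.length := List.countP_le_length
  · rw [List.toFinset_card_of_nodup hnd, List.toFinset_card_of_nodup List.nodup_range]
    simp

theorem std_map {u : List ℕ} {f : ℕ → ℕ} (hf : ∀ x ∈ u, ∀ y ∈ u, x < y → f x < f y) :
    std (u.map f) = std u := by
  simp only [std, List.map_map]
  apply List.map_congr_left
  intro x hx
  simp only [Function.comp_apply, List.countP_map]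
  apply List.countP_congr
  intro y hy
  simp only [Function.comp_apply, decide_eq_true_eq]
  constructor
  · intro h
    by_contra h2
    rcases lt_or_eq_of_le (not_lt.1 h2) with h3 | h3
    · have := hf x hx y hy h3
      omega
    · subst h3
      omega
  · exact hf y hy x hx

theorem std_eq_self {w : List ℕ} (hw : w.Perm (List.range w.length)) : std w = w := by
  have hc : ∀ n x : ℕ, (List.range n).countP (· < x) = min x n := by
    intro n x
    induction n with
    | zero => simp
    | succ n ih =>
      rw [List.range_succ, List.countP_append, ih]
      simp only [List.countP_cons, List.countP_nil, decide_eq_true_eq]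
      split_ifs <;> omega
  conv_rhs => rw [← List.map_id w]
  apply List.map_congr_left
  intro x hx
  have hx2 : x < w.length := List.mem_range.1 (hw.mem_iff.1 hx)
  rw [hw.countP_eq, hc]
  simp only [id]
  omega

end Std

/-! ### The Hopf algebra of free quasi-symmetric functions -/

/-- Permutations of all sizes, seen as words: a permutation of size `n` is a word of length `n`
without repetition on the first `n` letters `0, …, n - 1` of the alphabet. -/
abbrev PermWord : Type := {w : List ℕ // w.Perm (List.range w.length)}

namespace PermWord

/-- The permutation of size `0`. -/
def empty : PermWord := ⟨[], List.Perm.refl _⟩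

theorem nodup (σ : PermWord) : σ.1.Nodup := σ.2.nodup_iff.2 List.nodup_range

/-- The standardization of a word without repetition, as a permutation. -/
def ofNodup (u : List ℕ) (hu : u.Nodup) : PermWord := ⟨std u, std_perm hu⟩

/-- The standardization of the prefix of length `i` of a permutation. -/
def stdTake (i : ℕ) (σ : PermWord) : PermWord :=
  ofNodup (σ.1.take i) (σ.nodup.sublist (List.take_sublist i σ.1))

/-- The standardization of the suffix of a permutation that starts after `i` letters. -/
def stdDrop (i : ℕ) (σ : PermWord) : PermWord :=
  ofNodup (σ.1.drop i) (σ.nodup.sublist (List.drop_sublist i σ.1))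

theorem length_stdTake (i : ℕ) (σ : PermWord) :
    (stdTake i σ).1.length = min i σ.1.length := by
  simp [stdTake, ofNodup, std]

theorem length_stdDrop (i : ℕ) (σ : PermWord) :
    (stdDrop i σ).1.length = σ.1.length - i := by
  simp [stdDrop, ofNodup, std]

theorem perm_of_mem_shuffle_shift (σ ν : PermWord) :
    ∀ w ∈ shuffle σ.1 (ν.1.map (· + σ.1.length)), w.Perm (List.range w.length) := by
  intro w hw
  have h := perm_of_mem_shuffle _ _ w hw
  have hlen : w.length = σ.1.length + ν.1.length := by
    simpa using h.length_eq
  rw [hlen, List.range_add]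
  refine h.trans (σ.2.append ?_)
  have h2 := ν.2.map (· + σ.1.length)
  simpa [add_comm] using h2

/-- The shifted shuffle product of two permutations, as a multiset of permutations. -/
def shiftedShuffle (σ ν : PermWord) : Multiset PermWord :=
  (shuffle σ.1 (ν.1.map (· + σ.1.length))).pmap Subtype.mk (perm_of_mem_shuffle_shift σ ν)

end PermWord

/-- The underlying module of the algebra of free quasi-symmetric functions: the free module on
all permutations. -/
def FQSym (K : Type*) [CommRing K] : Type _ := PermWord →₀ K

namespace FQSym

variable (K : Type*) [CommRing K]

noncomputable instance : AddCommGroup (FQSym K) := inferInstanceAs (AddCommGroup (PermWord →₀ K))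

noncomputable instance : Module K (FQSym K) := inferInstanceAs (Module K (PermWord →₀ K))

/-- The fundamental basis element indexed by a permutation. -/
noncomputable def F (σ : PermWord) : FQSym K := Finsupp.single σ (1 : K)

/-- The linear map on `FQSym` with prescribed values on the fundamental basis. -/
noncomputable def extend {M : Type*} [AddCommGroup M] [Module K M] (f : PermWord → M) :
    FQSym K →ₗ[K] M :=
  Finsupp.linearCombination K f

variable {K} in
theorem extend_F {M : Type*} [AddCommGroup M] [Module K M] (f : PermWord → M) (σ : PermWord) :
    extend K f (F K σ) = f σ := by
  unfold extend F
  exact (Finsupp.linearCombination_single K (1 : K) σ).trans (one_smul K _)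

variable {K} in
theorem hom_ext {M : Type*} [AddCommGroup M] [Module K M] {f g : FQSym K →ₗ[K] M}
    (h : ∀ σ, f (F K σ) = g (F K σ)) : f = g :=
  Finsupp.lhom_ext' fun σ => LinearMap.ext_ring (h σ)

/-- The product: the bilinear map sending `(F σ, F ν)` to the sum of the `F π` for `π` in the
shifted shuffle of `σ` and `ν`. -/
noncomputable def mulMap : FQSym K →ₗ[K] FQSym K →ₗ[K] FQSym K :=
  extend K fun σ => extend K fun ν => ((PermWord.shiftedShuffle σ ν).map (F K)).sum

/-- The coproduct: the linear map sending `F σ` to the sum of the `F (std u) ⊗ F (std v)` over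
all factorizations `σ = u v`. -/
noncomputable def comulMap : FQSym K →ₗ[K] FQSym K ⊗[K] FQSym K :=
  extend K fun σ => ∑ i ∈ Finset.range (σ.1.length + 1),
    F K (PermWord.stdTake i σ) ⊗ₜ[K] F K (PermWord.stdDrop i σ)

/-- The counit: the coefficient of the empty permutation. -/
noncomputable def counitMap : FQSym K →ₗ[K] K :=
  extend K fun σ => if σ.1 = [] then 1 else 0

/-- The element `F (std u)` for a word `u` without repetition. -/
noncomputable def G (u : List ℕ) : FQSym K :=
  if h : u.Nodup then F K (PermWord.ofNodup u h) else 0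

variable {K}

theorem G_of_nodup {u : List ℕ} (h : u.Nodup) : G K u = F K (PermWord.ofNodup u h) :=
  dif_pos h

theorem G_perm (σ : PermWord) : G K σ.1 = F K σ := by
  rw [G_of_nodup σ.nodup]
  congr 1
  exact Subtype.ext (std_eq_self σ.2)

theorem G_map {u : List ℕ} (hu : u.Nodup) {f : ℕ → ℕ}
    (hf : ∀ x ∈ u, ∀ y ∈ u, x < y → f x < f y) : G K (u.map f) = G K u := by
  have hnd : (u.map f).Nodup := by
    refine List.Nodup.map_on ?_ hu
    intro x hx y hy h
    rcases lt_trichotomy x y with hxy | hxy | hxy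
    · have := hf x hx y hy hxy
      omega
    · exact hxy
    · have := hf y hy x hx hxy
      omega
  rw [G_of_nodup hnd, G_of_nodup hu]
  congr 1
  exact Subtype.ext (std_map hf)

theorem G_std {u : List ℕ} (hu : u.Nodup) : G K (std u) = G K u :=
  G_map hu fun _ hx _ _ hxy => countP_lt_strictMono u hx hxy

theorem mulMap_F (σ ν : PermWord) :
    mulMap K (F K σ) (F K ν) =
      ((shuffle σ.1 (ν.1.map (· + σ.1.length))).map (G K)).sum := by
  rw [mulMap, extend_F, extend_F, PermWord.shiftedShuffle, Multiset.map_pmap]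
  congr 1
  rw [← Multiset.pmap_eq_map (fun w => w.Perm (List.range w.length)) (G K) _
    (PermWord.perm_of_mem_shuffle_shift σ ν)]
  exact Multiset.pmap_congr _ fun w _ h _ => (G_perm ⟨w, h⟩).symm

theorem mulMap_G {u v : List ℕ} (huv : (u ++ v).Nodup) (hlt : ∀ x ∈ u, ∀ y ∈ v, x < y) :
    mulMap K (G K u) (G K v) = ((shuffle u v).map (G K)).sum := by
  obtain ⟨hu, hv, -⟩ := List.nodup_append.1 huv
  rw [G_of_nodup hu, G_of_nodup hv, mulMap_F]
  have h1 : (PermWord.ofNodup u hu).1 = u.map fun x => (u ++ v).countP (· < x) := by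
    apply List.map_congr_left
    intro x hx
    rw [List.countP_append]
    have : v.countP (· < x) = 0 := by
      rw [List.countP_eq_zero]
      intro y hy
      have := hlt x hx y hy
      simp only [decide_eq_true_eq]
      omega
    omega
  have h2 : (PermWord.ofNodup v hv).1.map (· + (PermWord.ofNodup u hu).1.length) =
      v.map fun x => (u ++ v).countP (· < x) := by
    simp only [PermWord.ofNodup, std, List.map_map, List.length_map]
    apply List.map_congr_left
    intro x hx
    rw [List.countP_append]
    have : u.countP (· < x) = u.length := by
      rw [List.countP_eq_length]
      intro y hy
      simpa using hlt y hy x hx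
    simp only [Function.comp_apply]
    omega
  rw [h2, h1, shuffle_map, Multiset.map_map]
  congr 1
  apply Multiset.map_congr rfl
  intro w hw
  have hp := perm_of_mem_shuffle _ _ w hw
  refine G_map (hp.nodup_iff.2 huv) ?_
  intro x hx y _ hxy
  exact countP_lt_strictMono _ (hp.mem_iff.1 hx) hxy

theorem sum_map_linear {ι M N : Type*} [AddCommGroup M] [Module K M] [AddCommGroup N] [Module K N]
    (f : M →ₗ[K] N) (s : Multiset ι) (g : ι → M) :
    f (s.map g).sum = (s.map fun i => f (g i)).sum := by
  rw [map_multiset_sum, Multiset.map_map]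
  rfl

theorem induct {p : FQSym K → Prop} (hF : ∀ σ, p (F K σ)) (h0 : p 0)
    (hadd : ∀ x y, p x → p y → p (x + y)) (hsmul : ∀ (c : K) x, p x → p (c • x)) (x : FQSym K) :
    p x := by
  refine Finsupp.induction_linear (motive := p) x h0 (fun f g hf hg => hadd f g hf hg) ?_
  intro σ c
  have h := hsmul c _ (hF σ)
  have e : c • F K σ = (Finsupp.single σ c : PermWord →₀ K) := by
    refine (Finsupp.smul_single c σ (1 : K)).trans ?_
    rw [smul_eq_mul, mul_one]
  rwa [e] at h

theorem range_shift_lt {n : ℕ} {w : List ℕ} (hw : w.Perm (List.range w.length)) (hn : w.length = n) :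
    ∀ x ∈ w, x < n := by
  intro x hx
  have := List.mem_range.1 (hw.mem_iff.1 hx)
  omega

theorem G_shift (σ : PermWord) (k : ℕ) : G K (σ.1.map (· + k)) = F K σ := by
  rw [G_map σ.nodup, G_perm]
  intro x _ y _ h
  exact Nat.add_lt_add_right h k

theorem nodup_shift (σ : PermWord) (k : ℕ) : (σ.1.map (· + k)).Nodup :=
  σ.nodup.map fun _ _ h => Nat.add_right_cancel h

theorem mem_shift {σ : PermWord} {k x : ℕ} (h : x ∈ σ.1.map (· + k)) :
    k ≤ x ∧ x < σ.1.length + k := by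
  obtain ⟨y, hy, rfl⟩ := List.mem_map.1 h
  have := List.mem_range.1 (σ.2.mem_iff.1 hy)
  omega

theorem mulMap_assoc (x y z : FQSym K) :
    mulMap K (mulMap K x y) z = mulMap K x (mulMap K y z) := by
  induction x using induct with
  | h0 => simp
  | hadd x1 x2 h1 h2 => simp [h1, h2]
  | hsmul c x h => simp [h]
  | hF σ =>
  induction y using induct with
  | h0 => simp
  | hadd x1 x2 h1 h2 => simp [h1, h2]
  | hsmul c x h => simp [h]
  | hF ν =>
  induction z using induct with
  | h0 => simp
  | hadd x1 x2 h1 h2 => simp [h1, h2]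
  | hsmul c x h => simp [h]
  | hF π =>
  obtain ⟨u, hu⟩ : ∃ u, u = σ.1.map (· + 0) := ⟨_, rfl⟩
  obtain ⟨v, hv⟩ : ∃ v, v = ν.1.map (· + σ.1.length) := ⟨_, rfl⟩
  obtain ⟨w, hw⟩ : ∃ w, w = π.1.map (· + (σ.1.length + ν.1.length)) := ⟨_, rfl⟩
  have eu : G K u = F K σ := hu ▸ G_shift σ _
  have ev : G K v = F K ν := hv ▸ G_shift ν _
  have ew : G K w = F K π := hw ▸ G_shift π _
  have nu : u.Nodup := hu ▸ nodup_shift σ _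
  have nv : v.Nodup := hv ▸ nodup_shift ν _
  have nw : w.Nodup := hw ▸ nodup_shift π _
  have luv : ∀ x ∈ u, ∀ y ∈ v, x < y := by
    intro x hx y hy
    have h1 := mem_shift (hu ▸ hx)
    have h2 := mem_shift (hv ▸ hy)
    omega
  have luw : ∀ x ∈ u, ∀ y ∈ w, x < y := by
    intro x hx y hy
    have h1 := mem_shift (hu ▸ hx)
    have h2 := mem_shift (hw ▸ hy)
    omega
  have lvw : ∀ x ∈ v, ∀ y ∈ w, x < y := by
    intro x hx y hy
    have h1 := mem_shift (hv ▸ hx)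
    have h2 := mem_shift (hw ▸ hy)
    omega
  have nuv : (u ++ v).Nodup :=
    List.nodup_append.2 ⟨nu, nv, fun x hx y hy => (luv x hx y hy).ne⟩
  have nvw : (v ++ w).Nodup :=
    List.nodup_append.2 ⟨nv, nw, fun x hx y hy => (lvw x hx y hy).ne⟩
  rw [← eu, ← ev, ← ew, mulMap_G nuv luv, mulMap_G nvw lvw, sum_map_linear (mulMap K (G K u))]
  have hl : mulMap K ((shuffle u v).map (G K)).sum (G K w) =
      ((shuffle u v).map fun x => mulMap K (G K x) (G K w)).sum :=
    sum_map_linear ((mulMap K).flip (G K w)) _ _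
  rw [hl]
  have h1 : ∀ x ∈ shuffle u v, mulMap K (G K x) (G K w) = ((shuffle x w).map (G K)).sum := by
    intro x hx
    have hp := perm_of_mem_shuffle _ _ x hx
    have hlt : ∀ a ∈ x, ∀ b ∈ w, a < b := by
      intro a ha b hb
      rcases List.mem_append.1 (hp.mem_iff.1 ha) with h | h
      · exact luw a h b hb
      · exact lvw a h b hb
    refine mulMap_G (List.nodup_append.2 ⟨hp.nodup_iff.2 nuv, nw, ?_⟩) hlt
    exact fun a ha b hb => (hlt a ha b hb).ne
  have h2 : ∀ x ∈ shuffle v w, mulMap K (G K u) (G K x) = ((shuffle u x).map (G K)).sum := by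
    intro x hx
    have hp := perm_of_mem_shuffle _ _ x hx
    have hlt : ∀ a ∈ u, ∀ b ∈ x, a < b := by
      intro a ha b hb
      rcases List.mem_append.1 (hp.mem_iff.1 hb) with h | h
      · exact luv a ha b h
      · exact luw a ha b h
    refine mulMap_G (List.nodup_append.2 ⟨nu, hp.nodup_iff.2 nvw, ?_⟩) hlt
    exact fun a ha b hb => (hlt a ha b hb).ne
  rw [Multiset.map_congr rfl h1, Multiset.map_congr rfl h2, ← Multiset.sum_bind,
    ← Multiset.sum_bind, ← Multiset.map_bind, ← Multiset.map_bind, shuffle_assoc]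

theorem one_mulMap (x : FQSym K) : mulMap K (F K PermWord.empty) x = x := by
  induction x using induct with
  | h0 => simp
  | hadd x1 x2 h1 h2 => simp [h1, h2]
  | hsmul c x h => simp [h]
  | hF σ =>
    rw [mulMap_F]
    simp [PermWord.empty, shuffle_nil_left, G_perm]

theorem mulMap_one (x : FQSym K) : mulMap K x (F K PermWord.empty) = x := by
  induction x using induct with
  | h0 => simp
  | hadd x1 x2 h1 h2 => simp [h1, h2]
  | hsmul c x h => simp [h]
  | hF σ =>
    rw [mulMap_F]
    simp [PermWord.empty, shuffle_nil_right, G_perm]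

noncomputable instance : Mul (FQSym K) := ⟨fun x y => mulMap K x y⟩

noncomputable instance : One (FQSym K) := ⟨F K PermWord.empty⟩

theorem mul_def (x y : FQSym K) : x * y = mulMap K x y := rfl

theorem one_def : (1 : FQSym K) = F K PermWord.empty := rfl

noncomputable instance : Ring (FQSym K) :=
  { (inferInstance : AddCommGroup (FQSym K)) with
    mul := (· * ·)
    one := 1
    mul_assoc := mulMap_assoc
    one_mul := one_mulMap
    mul_one := mulMap_one
    left_distrib := fun x y z => map_add (mulMap K x) y z
    right_distrib := fun x y z => LinearMap.map_add₂ (mulMap K) x y z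
    zero_mul := fun x => LinearMap.map_zero₂ (mulMap K) x
    mul_zero := fun x => map_zero (mulMap K x) }

noncomputable instance : Algebra K (FQSym K) :=
  Algebra.ofModule (fun c x y => LinearMap.map_smul₂ (mulMap K) c x y)
    (fun c x y => map_smul (mulMap K x) c y)

theorem comulMap_G {u : List ℕ} (hu : u.Nodup) :
    comulMap K (G K u) = cutSum (fun x y => G K x ⊗ₜ[K] G K y) u := by
  rw [G_of_nodup hu, comulMap, extend_F, cutSum]
  have hl : (PermWord.ofNodup u hu).1.length = u.length := by
    simp [PermWord.ofNodup, std]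
  rw [hl]
  refine Finset.sum_congr rfl fun i _ => ?_
  have hn := (PermWord.ofNodup u hu).nodup
  have h1 : F K (PermWord.stdTake i (PermWord.ofNodup u hu)) = G K (u.take i) := by
    rw [PermWord.stdTake, ← G_of_nodup]
    simp only [PermWord.ofNodup, std, ← List.map_take]
    exact G_map (hu.sublist (List.take_sublist i u)) fun x hx y _ hxy =>
      countP_lt_strictMono u (List.mem_of_mem_take hx) hxy
  have h2 : F K (PermWord.stdDrop i (PermWord.ofNodup u hu)) = G K (u.drop i) := by
    rw [PermWord.stdDrop, ← G_of_nodup]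
    simp only [PermWord.ofNodup, std, ← List.map_drop]
    exact G_map (hu.sublist (List.drop_sublist i u)) fun x hx y _ hxy =>
      countP_lt_strictMono u (List.mem_of_mem_drop hx) hxy
  rw [h1, h2]

theorem counitMap_G {u : List ℕ} (hu : u.Nodup) :
    counitMap K (G K u) = if u = [] then 1 else 0 := by
  rw [G_of_nodup hu, counitMap, extend_F]
  simp [PermWord.ofNodup, std]

theorem map_cutSum {M N : Type*} [AddCommGroup M] [Module K M] [AddCommGroup N] [Module K N]
    (f : M →ₗ[K] N) (g : List ℕ → List ℕ → M) (u : List ℕ) :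
    f (cutSum g u) = cutSum (fun x y => f (g x y)) u := map_sum f _ _

theorem cutSum_congr {M : Type*} [AddCommMonoid M] {f g : List ℕ → List ℕ → M} {u : List ℕ}
    (h : ∀ x y, x ++ y = u → f x y = g x y) : cutSum f u = cutSum g u :=
  Finset.sum_congr rfl fun i _ => h _ _ (List.take_append_drop i u)

noncomputable instance : CoalgebraStruct K (FQSym K) where
  comul := comulMap K
  counit := counitMap K

theorem comul_G {u : List ℕ} (hu : u.Nodup) :
    Coalgebra.comul (R := K) (G K u) = cutSum (fun x y => G K x ⊗ₜ[K] G K y) u :=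
  comulMap_G hu

theorem counit_G {u : List ℕ} (hu : u.Nodup) :
    Coalgebra.counit (R := K) (G K u) = if u = [] then (1 : K) else 0 :=
  counitMap_G hu

theorem hom_ext_G {M : Type*} [AddCommGroup M] [Module K M] {f g : FQSym K →ₗ[K] M}
    (h : ∀ u : List ℕ, u.Nodup → f (G K u) = g (G K u)) : f = g :=
  hom_ext fun σ => by rw [← G_perm σ]; exact h _ σ.nodup

theorem cutSum_left_nil {M : Type*} [AddCommMonoid M] (f : List ℕ → List ℕ → M) (u : List ℕ)
    (h : ∀ x y, x ≠ [] → f x y = 0) : cutSum f u = f [] u := by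
  cases u with
  | nil => exact cutSum_nil f
  | cons a u =>
    rw [cutSum_cons]
    have : cutSum (fun x y => f (a :: x) y) u = 0 :=
      Finset.sum_eq_zero fun i _ => h _ _ (by simp)
    rw [this, add_zero]

theorem cutSum_right_nil {M : Type*} [AddCommMonoid M] (f : List ℕ → List ℕ → M) (u : List ℕ)
    (h : ∀ x y, y ≠ [] → f x y = 0) : cutSum f u = f u [] := by
  induction u generalizing f with
  | nil => exact cutSum_nil f
  | cons a u ih => rw [cutSum_cons, h _ _ (by simp), zero_add, ih _ fun x y hy => h _ _ hy]

noncomputable instance : Coalgebra K (FQSym K) where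
  coassoc := by
    refine hom_ext_G fun u hu => ?_
    simp only [LinearMap.comp_apply, LinearEquiv.coe_coe, comul_G hu]
    have e1 : cutSum (fun x y => (Coalgebra.comul (R := K)).rTensor (FQSym K)
        (G K x ⊗ₜ[K] G K y)) u =
        cutSum (fun x y => cutSum (fun x1 x2 => (G K x1 ⊗ₜ[K] G K x2) ⊗ₜ[K] G K y) x) u := by
      refine cutSum_congr fun x y hxy => ?_
      have hx : x.Nodup := (List.nodup_append.1 (hxy ▸ hu)).1
      rw [LinearMap.rTensor_tmul, comul_G hx]
      exact map_cutSum ((TensorProduct.mk K _ _).flip (G K y)) _ _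
    have e2 : cutSum (fun x y => (Coalgebra.comul (R := K)).lTensor (FQSym K)
        (G K x ⊗ₜ[K] G K y)) u =
        cutSum (fun x y => cutSum (fun y1 y2 => G K x ⊗ₜ[K] (G K y1 ⊗ₜ[K] G K y2)) y) u := by
      refine cutSum_congr fun x y hxy => ?_
      have hy : y.Nodup := (List.nodup_append.1 (hxy ▸ hu)).2.1
      rw [LinearMap.lTensor_tmul, comul_G hy]
      exact map_cutSum (TensorProduct.mk K _ _ (G K x)) _ _
    rw [map_cutSum, map_cutSum, e1, e2, ← cutSum_cutSum,
      ← LinearEquiv.coe_coe, map_cutSum]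
    simp only [map_cutSum, LinearEquiv.coe_coe, TensorProduct.assoc_tmul]
  rTensor_counit_comp_comul := by
    refine hom_ext_G fun u hu => ?_
    rw [LinearMap.comp_apply, comul_G hu, map_cutSum]
    have e : cutSum (fun x y => (Coalgebra.counit (R := K)).rTensor (FQSym K)
        (G K x ⊗ₜ[K] G K y)) u =
        cutSum (fun x y => (if x = [] then (1 : K) else 0) ⊗ₜ[K] G K y) u := by
      refine cutSum_congr fun x y hxy => ?_
      rw [LinearMap.rTensor_tmul, counit_G (List.nodup_append.1 (hxy ▸ hu)).1]
    rw [e, cutSum_left_nil]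
    · simp
    · intro x y hx
      simp [hx]
  lTensor_counit_comp_comul := by
    refine hom_ext_G fun u hu => ?_
    rw [LinearMap.comp_apply, comul_G hu, map_cutSum]
    have e : cutSum (fun x y => (Coalgebra.counit (R := K)).lTensor (FQSym K)
        (G K x ⊗ₜ[K] G K y)) u =
        cutSum (fun x y => G K x ⊗ₜ[K] (if y = [] then (1 : K) else 0)) u := by
      refine cutSum_congr fun x y hxy => ?_
      rw [LinearMap.lTensor_tmul, counit_G (List.nodup_append.1 (hxy ▸ hu)).2.1]
    rw [e, cutSum_right_nil]
    · simp
    · intro x y hx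
      simp [hx]


theorem mul_G {u v : List ℕ} (huv : (u ++ v).Nodup) (hlt : ∀ x ∈ u, ∀ y ∈ v, x < y) :
    G K u * G K v = ((shuffle u v).map (G K)).sum :=
  mulMap_G huv hlt

theorem F_eq_G_pair (σ ν : PermWord) : ∃ u v : List ℕ, (u ++ v).Nodup ∧
    (∀ x ∈ u, ∀ y ∈ v, x < y) ∧ F K σ = G K u ∧ F K ν = G K v ∧
    (u = [] ↔ σ.1 = []) ∧ (v = [] ↔ ν.1 = []) := by
  have hlt : ∀ x ∈ σ.1, ∀ y ∈ ν.1.map (· + σ.1.length), x < y := by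
    intro x hx y hy
    have h1 := List.mem_range.1 (σ.2.mem_iff.1 hx)
    have h2 := mem_shift hy
    omega
  exact ⟨σ.1, ν.1.map (· + σ.1.length),
    List.nodup_append.2 ⟨σ.nodup, nodup_shift ν _, fun x hx y hy => (hlt x hx y hy).ne⟩,
    hlt, (G_perm σ).symm, (G_shift ν _).symm, Iff.rfl, List.map_eq_nil_iff⟩

theorem counit_mul' (x y : FQSym K) : Coalgebra.counit (R := K) (x * y) =
    Coalgebra.counit (R := K) x * Coalgebra.counit (R := K) y := by
  induction x using induct with
  | h0 => simp
  | hadd x1 x2 h1 h2 => simp [add_mul, h1, h2]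
  | hsmul c x h => simp [h, mul_assoc]
  | hF σ =>
  induction y using induct with
  | h0 => simp
  | hadd x1 x2 h1 h2 => simp [mul_add, h1, h2]
  | hsmul c x h => simp [h, mul_left_comm]
  | hF ν =>
  obtain ⟨u, v, huv, hlt, e1, e2, -, -⟩ := F_eq_G_pair (K := K) σ ν
  rw [e1, e2, mul_G huv hlt, sum_map_linear]
  obtain ⟨hu, hv, -⟩ := List.nodup_append.1 huv
  rw [counit_G hu, counit_G hv]
  have h : ∀ w ∈ shuffle u v, Coalgebra.counit (R := K) (G K w) =
      if u ++ v = [] then (1 : K) else 0 := by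
    intro w hw
    have hp := perm_of_mem_shuffle _ _ w hw
    rw [counit_G (hp.nodup_iff.2 huv)]
    have : w = [] ↔ u ++ v = [] := by
      rw [← List.length_eq_zero_iff, hp.length_eq, List.length_eq_zero_iff]
    simp only [this]
  rw [Multiset.map_congr rfl h]
  by_cases hu0 : u = []
  · subst hu0
    simp [shuffle_nil_left]
  · simp [hu0]

theorem cutSum_mul (f g : List ℕ → List ℕ → FQSym K ⊗[K] FQSym K) (u v : List ℕ) :
    cutSum f u * cutSum g v =
      cutSum (fun u1 u2 => cutSum (fun v1 v2 => f u1 u2 * g v1 v2) v) u := by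
  simp only [cutSum, Finset.sum_mul_sum]

theorem comul_mul' (x y : FQSym K) : Coalgebra.comul (R := K) (x * y) =
    Coalgebra.comul (R := K) x * Coalgebra.comul (R := K) y := by
  induction x using induct with
  | h0 => simp
  | hadd x1 x2 h1 h2 => simp [add_mul, h1, h2]
  | hsmul c x h => rw [smul_mul_assoc, map_smul, map_smul, h, smul_mul_assoc]
  | hF σ =>
  induction y using induct with
  | h0 => simp
  | hadd x1 x2 h1 h2 => simp [mul_add, h1, h2]
  | hsmul c x h => rw [mul_smul_comm, map_smul, map_smul, h, mul_smul_comm]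
  | hF ν =>
  obtain ⟨u, v, huv, hlt, e1, e2, -, -⟩ := F_eq_G_pair (K := K) σ ν
  rw [e1, e2, mul_G huv hlt, sum_map_linear]
  obtain ⟨hu, hv, hd⟩ := List.nodup_append.1 huv
  rw [comul_G hu, comul_G hv, cutSum_mul]
  have h : ∀ w ∈ shuffle u v, Coalgebra.comul (R := K) (G K w) =
      cutSum (fun x y => G K x ⊗ₜ[K] G K y) w := fun w hw =>
    comul_G ((perm_of_mem_shuffle _ _ w hw).nodup_iff.2 huv)
  rw [Multiset.map_congr rfl h, shuffle_cutSum]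
  refine cutSum_congr fun u1 u2 hu12 => cutSum_congr fun v1 v2 hv12 => ?_
  subst hu12 hv12
  have n1 := List.nodup_append.1 hu
  have n2 := List.nodup_append.1 hv
  have l1 : ∀ x ∈ u1, ∀ y ∈ v1, x < y := fun x hx y hy =>
    hlt x (List.mem_append_left _ hx) y (List.mem_append_left _ hy)
  have l2 : ∀ x ∈ u2, ∀ y ∈ v2, x < y := fun x hx y hy =>
    hlt x (List.mem_append_right _ hx) y (List.mem_append_right _ hy)
  rw [Algebra.TensorProduct.tmul_mul_tmul,
    mul_G (List.nodup_append.2 ⟨n1.1, n2.1, fun x hx y hy => (l1 x hx y hy).ne⟩) l1,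
    mul_G (List.nodup_append.2 ⟨n1.2.1, n2.2.1, fun x hx y hy => (l2 x hx y hy).ne⟩) l2]
  rw [shufflePairSum]
  have e : ∀ t : FQSym K, ((shuffle u1 v1).map (G K)).sum ⊗ₜ[K] t =
      ((shuffle u1 v1).map fun x => G K x ⊗ₜ[K] t).sum := fun t =>
    sum_map_linear ((TensorProduct.mk K _ _).flip t) _ _
  rw [e]
  congr 1
  refine Multiset.map_congr rfl fun x _ => ?_
  exact (sum_map_linear (TensorProduct.mk K _ _ (G K x)) _ _).symm

theorem one_eq_G : (1 : FQSym K) = G K [] := (G_perm PermWord.empty).symm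

noncomputable instance : Bialgebra K (FQSym K) :=
  Bialgebra.mk' K (FQSym K)
    (by rw [one_eq_G, counit_G List.nodup_nil]; simp)
    (fun {x y} => counit_mul' x y)
    (by rw [one_eq_G, comul_G List.nodup_nil, cutSum_nil, ← one_eq_G]; rfl)
    (fun {x y} => comul_mul' x y)

variable (K)

/-- The antipode on the fundamental basis: `S (F σ) = - ∑ S (F (std u)) * F (std v)`, where the
sum runs over the factorizations `σ = u v` with `v` nonempty. -/
noncomputable def antipodeF (σ : PermWord) : FQSym K :=
  if σ.1 = [] then 1
  else -∑ i : Fin σ.1.length, antipodeF (PermWord.stdTake i σ) * F K (PermWord.stdDrop i σ)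
termination_by σ.1.length
decreasing_by
  rw [PermWord.length_stdTake]
  omega

/-- The right convolution inverse of the identity on the fundamental basis; it is equal to the
antipode. -/
noncomputable def antipodeR (σ : PermWord) : FQSym K :=
  if σ.1 = [] then 1
  else -∑ i : Fin σ.1.length,
    F K (PermWord.stdTake (i + 1) σ) * antipodeR (PermWord.stdDrop (i + 1) σ)
termination_by σ.1.length
decreasing_by
  rw [PermWord.length_stdDrop]
  omega

/-- The antipode. -/
noncomputable def antipodeMap : FQSym K →ₗ[K] FQSym K := extend K (antipodeF K)

variable {K}

theorem comul_F (σ : PermWord) : Coalgebra.comul (R := K) (F K σ) =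
    ∑ i ∈ Finset.range (σ.1.length + 1),
      F K (PermWord.stdTake i σ) ⊗ₜ[K] F K (PermWord.stdDrop i σ) :=
  extend_F _ σ

theorem counit_F (σ : PermWord) :
    Coalgebra.counit (R := K) (F K σ) = if σ.1 = [] then (1 : K) else 0 :=
  extend_F _ σ

theorem stdTake_length (σ : PermWord) : PermWord.stdTake σ.1.length σ = σ :=
  Subtype.ext (by simp [PermWord.stdTake, PermWord.ofNodup, std_eq_self σ.2])

theorem stdDrop_zero (σ : PermWord) : PermWord.stdDrop 0 σ = σ :=
  Subtype.ext (by simp [PermWord.stdDrop, PermWord.ofNodup, std_eq_self σ.2])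

theorem F_of_nil {σ : PermWord} (h : σ.1 = []) : F K σ = 1 := by
  rw [one_def]
  congr 1
  exact Subtype.ext h

theorem antipodeF_eq (σ : PermWord) : antipodeF K σ = if σ.1 = [] then 1
    else -∑ i : Fin σ.1.length,
      antipodeF K (PermWord.stdTake i σ) * F K (PermWord.stdDrop i σ) := by
  conv_lhs => rw [antipodeF]

theorem antipodeR_eq (σ : PermWord) : antipodeR K σ = if σ.1 = [] then 1
    else -∑ i : Fin σ.1.length,
      F K (PermWord.stdTake (i + 1) σ) * antipodeR K (PermWord.stdDrop (i + 1) σ) := by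
  conv_lhs => rw [antipodeR]

theorem antipode_left : LinearMap.mul' K (FQSym K) ∘ₗ (antipodeMap K).rTensor (FQSym K) ∘ₗ
    Coalgebra.comul = Algebra.linearMap K (FQSym K) ∘ₗ Coalgebra.counit := by
  refine hom_ext fun σ => ?_
  simp only [LinearMap.comp_apply, comul_F, counit_F, map_sum, LinearMap.rTensor_tmul,
    LinearMap.mul'_apply, antipodeMap, extend_F]
  rw [Finset.sum_range_succ, stdTake_length,
    F_of_nil (K := K) (σ := PermWord.stdDrop σ.1.length σ)
      (List.length_eq_zero_iff.1 (by rw [PermWord.length_stdDrop]; omega)), mul_one]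
  rw [antipodeF_eq σ]
  split_ifs with h
  · simp [h]
  · rw [Finset.sum_range]
    simp

theorem antipode_right : LinearMap.mul' K (FQSym K) ∘ₗ (extend K (antipodeR K)).lTensor (FQSym K) ∘ₗ
    Coalgebra.comul = Algebra.linearMap K (FQSym K) ∘ₗ Coalgebra.counit := by
  refine hom_ext fun σ => ?_
  simp only [LinearMap.comp_apply, comul_F, counit_F, map_sum, LinearMap.lTensor_tmul,
    LinearMap.mul'_apply, extend_F]
  rw [Finset.sum_range_succ', stdDrop_zero,
    F_of_nil (K := K) (σ := PermWord.stdTake 0 σ)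
      (List.length_eq_zero_iff.1 (by rw [PermWord.length_stdTake]; omega)), one_mul]
  rw [antipodeR_eq σ]
  split_ifs with h
  · simp [h]
  · rw [Finset.sum_range]
    simp

theorem antipodeMap_eq : antipodeMap K = extend K (antipodeR K) := by
  have h1 : WithConv.toConv (antipodeMap K) * WithConv.toConv LinearMap.id = 1 :=
    congrArg WithConv.toConv (antipode_left (K := K))
  have h2 : WithConv.toConv LinearMap.id * WithConv.toConv (extend K (antipodeR K)) = 1 :=
    congrArg WithConv.toConv (antipode_right (K := K))
  exact WithConv.toConv_injective (left_inv_eq_right_inv h1 h2)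

noncomputable instance : HopfAlgebra K (FQSym K) where
  antipode := antipodeMap K
  mul_antipode_rTensor_comul := antipode_left
  mul_antipode_lTensor_comul := by
    rw [antipodeMap_eq]
    exact antipode_right

end FQSym

/-- A submodule of a Hopf algebra is a Hopf subalgebra if it is a subalgebra, a subcoalgebra
(the coproduct maps it into the image of its tensor square), and stable under the antipode. -/
structure IsHopfSubalgebra (K : Type*) {H : Type*} [CommRing K] [Ring H] [HopfAlgebra K H]
    (V : Submodule K H) : Prop where
  one_mem : (1 : H) ∈ V
  mul_mem : ∀ x ∈ V, ∀ y ∈ V, x * y ∈ V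
  comul_mem : ∀ x ∈ V, Coalgebra.comul (R := K) x ∈
    LinearMap.range (TensorProduct.map V.subtype V.subtype)
  antipode_mem : ∀ x ∈ V, HopfAlgebra.antipode K x ∈ V

/-! ### Binary trees and the Baxter P-symbol -/

/-- Leaf insertion of a letter into a left binary search tree. -/
def leafInsertLeft (a : ℕ) : BinaryTree ℕ → BinaryTree ℕ
  | .nil => .node a .nil .nil
  | .node b l r =>
    if a < b then .node b (leafInsertLeft a l) r else .node b l (leafInsertLeft a r)

/-- Leaf insertion of a letter into a right binary search tree. -/
def leafInsertRight (a : ℕ) : BinaryTree ℕ → BinaryTree ℕ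
  | .nil => .node a .nil .nil
  | .node b l r =>
    if a ≤ b then .node b (leafInsertRight a l) r else .node b l (leafInsertRight a r)

/-- The left tree of the P-symbol: the letters are leaf inserted from left to right. -/
def leftTree (u : List ℕ) : BinaryTree ℕ := u.foldl (fun t a => leafInsertLeft a t) .nil

/-- The right tree of the P-symbol: the letters are leaf inserted from right to left. -/
def rightTree (u : List ℕ) : BinaryTree ℕ := u.foldr leafInsertRight .nil

/-- The Baxter P-symbol of a word: a pair of labeled binary trees. -/
def pSymbol (u : List ℕ) : BinaryTree ℕ × BinaryTree ℕ := (leftTree u, rightTree u)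

/-- The shape of a labeled binary tree. -/
def shape (t : BinaryTree ℕ) : BinaryTree Unit := t.map fun _ => ()

/-- The orientations of the leaves of a binary tree, from left to right: `false` (that is, `0`) for
a leaf oriented to the right (a right child), and `true` (that is, `1`) for a leaf oriented to the
left (a left child). The argument `o` is the orientation of the whole tree. -/
def leafOrientations (o : Bool) : BinaryTree Unit → List Bool
  | .nil => [o]
  | .node _ l r => leafOrientations true l ++ leafOrientations false r

/-- The canopy of a binary tree: the orientations of its leaves, from left to right, except the
first and the last one. (The value `true` given to the root does not matter.) -/
def canopy (t : BinaryTree Unit) : List Bool := (leafOrientations true t).tail.dropLast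

/-- A pair of binary trees is a pair of twin binary trees if both have the same number of nodes and
their canopies are complementary. -/
def IsTwin (p : BinaryTree Unit × BinaryTree Unit) : Prop :=
  p.1.numNodes = p.2.numNodes ∧ List.Forall₂ (· ≠ ·) (canopy p.1) (canopy p.2)

/-- The set of all pairs of twin binary trees. -/
abbrev TwinTrees : Type := {p : BinaryTree Unit × BinaryTree Unit // IsTwin p}

/-- The P-symbol of a permutation, regarded as an unlabeled pair of binary trees. -/
def pShape (σ : PermWord) : BinaryTree Unit × BinaryTree Unit :=
  (shape (pSymbol σ.1).1, shape (pSymbol σ.1).2)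

theorem numNodes_leafInsertLeft (a : ℕ) (t : BinaryTree ℕ) :
    (leafInsertLeft a t).numNodes = t.numNodes + 1 := by
  induction t with
  | nil => simp [leafInsertLeft]
  | node b l r hl hr =>
    rw [leafInsertLeft]
    split_ifs
    · simp only [BinaryTree.numNodes, hl]
      omega
    · simp only [BinaryTree.numNodes, hr]
      omega

theorem numNodes_shape (t : BinaryTree ℕ) : (shape t).numNodes = t.numNodes := by
  unfold shape
  induction t with
  | nil => rfl
  | node b l r hl hr => simp only [BinaryTree.map, BinaryTree.numNodes, hl, hr]

theorem numNodes_leftTree (u : List ℕ) : (leftTree u).numNodes = u.length := by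
  have h : ∀ (v : List ℕ) (t : BinaryTree ℕ),
      (v.foldl (fun t a => leafInsertLeft a t) t).numNodes = t.numNodes + v.length := by
    intro v
    induction v with
    | nil => simp
    | cons a v ih =>
      intro t
      rw [List.foldl_cons, ih, numNodes_leafInsertLeft, List.length_cons]
      omega
  simpa [leftTree] using h u .nil

theorem finite_fiber (p : BinaryTree Unit × BinaryTree Unit) :
    {σ : PermWord | pShape σ = p}.Finite := by
  have hinj : Function.Injective (Subtype.val : PermWord → List ℕ) := Subtype.val_injective
  refine Set.Finite.subset (Set.Finite.preimage hinj.injOn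
    ((List.range p.1.numNodes).permutations.finite_toSet)) ?_
  intro σ hσ
  have h : σ.1.length = p.1.numNodes := by
    rw [← (show pShape σ = p from hσ)]
    exact ((numNodes_shape _).trans (numNodes_leftTree _)).symm
  have h2 := σ.2
  rw [h] at h2
  exact List.mem_permutations.2 h2

/-- The element `P_J`: the sum of the `F σ` over all permutations `σ` whose P-symbol is `J`. -/
noncomputable def P (K : Type*) [CommRing K] (J : TwinTrees) : FQSym K :=
  ∑ σ ∈ (finite_fiber J.1).toFinset, FQSym.F K σ

/-- The linear span of the elements `P_J`. -/
noncomputable def Baxter (K : Type*) [CommRing K] : Submodule K (FQSym K) :=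
  Submodule.span K (Set.range (P K))

end BaxterHopf

namespace BaxterHopf

open scoped TensorProduct

/-! ### Binary search trees -/

/-! The fibres of the P-symbol are the classes of a congruence that respects every operation from
which the product and the coproduct are built. On words without repetition the right tree is the
left tree of the reversed word (`rightTree_eq`), so everything reduces to one kind of insertion.
Among rearrangements of the same letters the shape of a tree determines its labels, since the infix
reading is sorted; hence equality of unlabeled P-symbols amounts to `Congr`, equality of labeled
ones (`congr_of_wordShape_eq`). This relation is compatible with concatenation (`Congr.append`) and
with restriction to the letters below or above a threshold (`Congr.filter_lt`, `Congr.filter_ge`),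
and P-shapes are invariant under standardization (`wordShape_std`).

Product: a shifted shuffle of `σ` and `ν` is a permutation with prescribed restrictions to small and
large letters. So a product of two class sums is multiplicity free and its support is a union of
classes.

Coproduct: cut all members of a class after `i` letters and group them by the letter set of the
prefix and by the P-symbols of the two factors. Standardization maps each group bijectively onto a
product of two classes, so it contributes exactly one `P K I ⊗ₜ P K L` (`sum_stdTake_stdDrop_mem`).
The antipode follows by induction on the size from its recursive formula.

The twin condition enters through `isTwin_pShape`: every P-symbol is a twin pair, so every class sum
is one of the generators. That every twin pair is attained plays no role, an empty class giving the
generator 0. -/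

/-- Successive leaf insertion of the letters of a word into a binary search tree. -/
def insertWord (t : BinaryTree ℕ) (u : List ℕ) : BinaryTree ℕ :=
  u.foldl (fun t a => leafInsertLeft a t) t

theorem insertWord_cons (t : BinaryTree ℕ) (a : ℕ) (u : List ℕ) :
    insertWord t (a :: u) = insertWord (leafInsertLeft a t) u := rfl

theorem leftTree_append (u v : List ℕ) : leftTree (u ++ v) = insertWord (leftTree u) v :=
  List.foldl_append

theorem leftTree_concat (u : List ℕ) (a : ℕ) :
    leftTree (u ++ [a]) = leafInsertLeft a (leftTree u) := leftTree_append u [a]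

/-- A letter is compared with the root once and then stays in one subtree, so the two subtrees grow
independently, each on its own subword. -/
theorem insertWord_node (b : ℕ) (l r : BinaryTree ℕ) (u : List ℕ) :
    insertWord (.node b l r) u =
      .node b (insertWord l (u.filter (· < b))) (insertWord r (u.filter (b ≤ ·))) := by
  induction u generalizing l r with
  | nil => rfl
  | cons a u ih =>
    rw [insertWord_cons, leafInsertLeft]
    by_cases h : a < b
    · rw [if_pos h, ih, List.filter_cons_of_pos (by simpa using h),
        List.filter_cons_of_neg (by simpa using h), insertWord_cons]
    · rw [if_neg h, ih, List.filter_cons_of_neg (by simpa using h),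
        List.filter_cons_of_pos (by simpa using h), insertWord_cons]

theorem leftTree_cons (a : ℕ) (u : List ℕ) :
    leftTree (a :: u) =
      .node a (leftTree (u.filter (· < a))) (leftTree (u.filter (a ≤ ·))) :=
  insertWord_node a .nil .nil u

/-! ### Restriction to small or large letters, and concatenation -/

/-- The restriction of a binary search tree to its labels smaller than `n`. -/
def cutLT (n : ℕ) : BinaryTree ℕ → BinaryTree ℕ
  | .nil => .nil
  | .node b l r => if b < n then .node b l (cutLT n r) else cutLT n l

/-- The restriction of a binary search tree to its labels greater than or equal to `n`. -/
def cutGE (n : ℕ) : BinaryTree ℕ → BinaryTree ℕ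
  | .nil => .nil
  | .node b l r => if b < n then cutGE n r else .node b (cutGE n l) r

/-- When the root `b` is discarded, so is its right subtree, and a letter sent there satisfies `n ≤
b ≤ a`; its insertion is invisible after the cut. -/
theorem cutLT_leafInsertLeft (n a : ℕ) (t : BinaryTree ℕ) :
    cutLT n (leafInsertLeft a t) = if a < n then leafInsertLeft a (cutLT n t) else cutLT n t := by
  induction t with
  | nil => simp [leafInsertLeft, cutLT]
  | node b l r hl hr => grind [leafInsertLeft, cutLT]

theorem cutGE_leafInsertLeft (n a : ℕ) (t : BinaryTree ℕ) :
    cutGE n (leafInsertLeft a t) = if n ≤ a then leafInsertLeft a (cutGE n t) else cutGE n t := by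
  induction t with
  | nil => grind [leafInsertLeft, cutGE]
  | node b l r hl hr => grind [leafInsertLeft, cutGE]

/-- The point is that the tree of the restricted word is a function of the tree of the whole word,
so that equality of trees survives restriction. -/
theorem leftTree_filter_lt (n : ℕ) (u : List ℕ) :
    leftTree (u.filter (· < n)) = cutLT n (leftTree u) := by
  induction u using List.reverseRecOn with
  | nil => rfl
  | append_singleton u a ih =>
    rw [leftTree_concat, cutLT_leafInsertLeft, List.filter_append]
    by_cases h : a < n <;> simp [h, leftTree_concat, ih]

theorem leftTree_filter_ge (n : ℕ) (u : List ℕ) :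
    leftTree (u.filter (n ≤ ·)) = cutGE n (leftTree u) := by
  induction u using List.reverseRecOn with
  | nil => rfl
  | append_singleton u a ih =>
    rw [leftTree_concat, cutGE_leafInsertLeft, List.filter_append]
    by_cases h : n ≤ a <;> simp [h, leftTree_concat, ih]

/-- Each empty subtree of `t` receives the letters of the word subject to the comparisons along its
branch. The tree grown there is obtained from `leftTree u` by cuts, so it depends on `u` only
through that tree. -/
theorem insertWord_congr {u v : List ℕ} (h : leftTree u = leftTree v) (t : BinaryTree ℕ) :
    insertWord t u = insertWord t v := by
  induction t generalizing u v with
  | nil => exact h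
  | node b l r hl hr =>
    have h1 : leftTree (u.filter (· < b)) = leftTree (v.filter (· < b)) := by
      rw [leftTree_filter_lt, leftTree_filter_lt, h]
    have h2 : leftTree (u.filter (b ≤ ·)) = leftTree (v.filter (b ≤ ·)) := by
      rw [leftTree_filter_ge, leftTree_filter_ge, h]
    rw [insertWord_node, insertWord_node, hl h1, hr h2]

theorem leftTree_append_congr {u u' v v' : List ℕ} (hu : leftTree u = leftTree u')
    (hv : leftTree v = leftTree v') : leftTree (u ++ v) = leftTree (u' ++ v') := by
  rw [leftTree_append, leftTree_append, hu, insertWord_congr hv]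

/-! ### Infix readings, and recovering the labels from the shape -/

/-- The labels of a binary tree in infix order. -/
def inorder : BinaryTree ℕ → List ℕ
  | .nil => []
  | .node b l r => inorder l ++ b :: inorder r

theorem inorder_leafInsertLeft_perm (a : ℕ) (t : BinaryTree ℕ) :
    (inorder (leafInsertLeft a t)).Perm (a :: inorder t) := by
  induction t with
  | nil => simp [leafInsertLeft, inorder]
  | node b l r hl hr =>
    rw [leafInsertLeft]
    split_ifs
    · exact hl.append_right _
    · simp only [inorder]
      exact ((hr.cons b).append_left _).trans
        (((List.Perm.swap a b _).append_left _).trans List.perm_middle)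

theorem inorder_leftTree_perm (u : List ℕ) : (inorder (leftTree u)).Perm u := by
  induction u using List.reverseRecOn with
  | nil => rfl
  | append_singleton u a ih =>
    rw [leftTree_concat]
    exact (inorder_leafInsertLeft_perm a _).trans
      ((ih.cons a).trans (List.perm_append_singleton a u).symm)

theorem inorder_leftTree_pairwise (u : List ℕ) : (inorder (leftTree u)).Pairwise (· ≤ ·) := by
  induction hn : u.length using Nat.strong_induction_on generalizing u with
  | _ n ih =>
    cases u with
    | nil => exact List.Pairwise.nil
    | cons a u =>
      have hlen : ∀ p : ℕ → Bool, (u.filter p).length < n := fun p => by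
        have := List.length_filter_le p u
        simp only [List.length_cons] at hn
        omega
      have mem : ∀ {p : ℕ → Bool} {x}, x ∈ inorder (leftTree (u.filter p)) → p x := fun hx =>
        (List.mem_filter.1 ((inorder_leftTree_perm _).mem_iff.1 hx)).2
      rw [leftTree_cons, inorder, List.pairwise_append, List.pairwise_cons]
      refine ⟨ih _ (hlen _) _ rfl, ⟨fun x hx => by simpa using mem hx, ih _ (hlen _) _ rfl⟩, ?_⟩
      intro x hx y hy
      have h1 : x < a := by simpa using mem hx
      rcases List.mem_cons.1 hy with rfl | hy
      · exact h1.le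
      · have h2 : a ≤ y := by simpa using mem hy
        omega

theorem inorder_leftTree_congr {u v : List ℕ} (h : u.Perm v) :
    inorder (leftTree u) = inorder (leftTree v) :=
  ((inorder_leftTree_perm u).trans (h.trans (inorder_leftTree_perm v).symm)).eq_of_pairwise
    (fun _ _ _ _ => le_antisymm) (inorder_leftTree_pairwise u) (inorder_leftTree_pairwise v)

theorem length_inorder (t : BinaryTree ℕ) : (inorder t).length = (shape t).numNodes := by
  rw [numNodes_shape]
  induction t with
  | nil => rfl
  | node b l r hl hr =>
    simp only [inorder, List.length_append, List.length_cons, hl, hr, BinaryTree.numNodes]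
    omega

theorem shape_node (b : ℕ) (l r : BinaryTree ℕ) :
    shape (.node b l r) = .node () (shape l) (shape r) := rfl

/-- The shape fixes the size of the left subtree, hence the position of the root label in the infix
reading; the two remaining pieces are treated recursively. -/
theorem eq_of_shape_of_inorder {s t : BinaryTree ℕ} (h : shape s = shape t)
    (hi : inorder s = inorder t) : s = t := by
  induction s generalizing t with
  | nil =>
    cases t with
    | nil => rfl
    | node b l r => exact absurd h (by simp [shape, BinaryTree.map])
  | node a l r hl hr =>
    cases t with
    | nil => exact absurd h (by simp [shape, BinaryTree.map])
    | node b l' r' =>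
      rw [shape_node, shape_node, BinaryTree.node.injEq] at h
      have hlen : (inorder l).length = (inorder l').length := by
        rw [length_inorder, length_inorder, h.2.1]
      obtain ⟨h1, h2⟩ := List.append_inj hi hlen
      obtain ⟨rfl, h3⟩ := List.cons.inj h2
      rw [hl h.2.1 h1, hr h.2.2 h3]

theorem leftTree_eq_of_shape_eq {u v : List ℕ} (h : u.Perm v)
    (hs : shape (leftTree u) = shape (leftTree v)) : leftTree u = leftTree v :=
  eq_of_shape_of_inorder hs (inorder_leftTree_congr h)

/-! ### Increasing relabelings, standardization, and the right tree -/

theorem leafInsertLeft_map {f : ℕ → ℕ} {a : ℕ} {t : BinaryTree ℕ}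
    (h : ∀ b ∈ inorder t, a < b ↔ f a < f b) :
    leafInsertLeft (f a) (t.map f) = (leafInsertLeft a t).map f := by
  induction t with
  | nil => rfl
  | node b l r hl hr =>
    simp only [inorder, List.mem_append, List.mem_cons] at h
    rw [BinaryTree.map, leafInsertLeft, leafInsertLeft, hl fun c hc => h c (Or.inl hc),
      hr fun c hc => h c (Or.inr (Or.inr hc))]
    simp only [← h b (Or.inr (Or.inl rfl))]
    split_ifs <;> rfl

theorem leftTree_map {f : ℕ → ℕ} {u : List ℕ} (h : ∀ a ∈ u, ∀ b ∈ u, a < b ↔ f a < f b) :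
    leftTree (u.map f) = (leftTree u).map f := by
  induction u using List.reverseRecOn with
  | nil => rfl
  | append_singleton u a ih =>
    rw [List.map_append, List.map_singleton, leftTree_concat, leftTree_concat,
      ih fun x hx y hy => h x (List.mem_append_left _ hx) y (List.mem_append_left _ hy)]
    refine leafInsertLeft_map fun b hb => h a (by simp) b ?_
    exact List.mem_append_left _ ((inorder_leftTree_perm u).mem_iff.1 hb)

theorem shape_map (f : ℕ → ℕ) (t : BinaryTree ℕ) : shape (t.map f) = shape t := by
  unfold shape
  induction t with
  | nil => rfl
  | node b l r hl hr => simp only [BinaryTree.map, hl, hr]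

theorem countP_lt_iff {u : List ℕ} {a b : ℕ} (ha : a ∈ u) (hb : b ∈ u) :
    a < b ↔ u.countP (· < a) < u.countP (· < b) := by
  refine ⟨countP_lt_strictMono u ha, fun h => ?_⟩
  rcases lt_trichotomy a b with hab | rfl | hab
  · exact hab
  · omega
  · have := countP_lt_strictMono u hb hab
    omega

theorem shape_leftTree_std (u : List ℕ) : shape (leftTree (std u)) = shape (leftTree u) := by
  rw [std, leftTree_map fun a ha b hb => countP_lt_iff ha hb, shape_map]

theorem shape_leftTree_reverse_std (u : List ℕ) :
    shape (leftTree (std u).reverse) = shape (leftTree u.reverse) := by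
  rw [std, ← List.map_reverse, leftTree_map, shape_map]
  exact fun a ha b hb => countP_lt_iff (List.mem_reverse.1 ha) (List.mem_reverse.1 hb)

theorem leafInsertRight_eq {a : ℕ} {t : BinaryTree ℕ} (h : a ∉ inorder t) :
    leafInsertRight a t = leafInsertLeft a t := by
  induction t with
  | nil => rfl
  | node b l r hl hr =>
    simp only [inorder, List.mem_append, List.mem_cons, not_or] at h
    rw [leafInsertRight, leafInsertLeft, hl h.1, hr h.2.2]
    simp only [le_iff_lt_or_eq, h.2.1, or_false]

/-- The two insertions treat only ties differently, and a word without repetition has none. From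
here on only left trees are needed. -/
theorem rightTree_eq {u : List ℕ} (hu : u.Nodup) : rightTree u = leftTree u.reverse := by
  induction u with
  | nil => rfl
  | cons a u ih =>
    obtain ⟨ha, hu⟩ := List.nodup_cons.1 hu
    rw [List.reverse_cons, leftTree_concat, ← ih hu, ← leafInsertRight_eq]
    · rfl
    · rw [ih hu, (inorder_leftTree_perm _).mem_iff, List.mem_reverse]
      exact ha

/-! ### The Baxter congruence -/

/-- The Baxter congruence on words without repetition: equality of the P-symbols. -/
def Congr (u v : List ℕ) : Prop :=
  leftTree u = leftTree v ∧ leftTree u.reverse = leftTree v.reverse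

/-- The pair of shapes of the P-symbol of a word without repetition. -/
def wordShape (u : List ℕ) : BinaryTree Unit × BinaryTree Unit :=
  (shape (leftTree u), shape (leftTree u.reverse))

theorem pShape_eq (σ : PermWord) : pShape σ = wordShape σ.1 := by
  rw [pShape, pSymbol, rightTree_eq σ.nodup, wordShape]

theorem pShape_ofNodup (u : List ℕ) (hu : u.Nodup) :
    pShape (PermWord.ofNodup u hu) = wordShape u := by
  rw [pShape_eq, wordShape, PermWord.ofNodup, shape_leftTree_std, shape_leftTree_reverse_std,
    wordShape]

theorem Congr.wordShape_eq {u v : List ℕ} (h : Congr u v) : wordShape u = wordShape v := by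
  rw [wordShape, h.1, h.2, wordShape]

/-- The fibres defining `P` forget the labels, while the arguments on concatenation and restriction
need them; between rearrangements of one word nothing is lost. -/
theorem congr_of_wordShape_eq {u v : List ℕ} (hp : u.Perm v) (h : wordShape u = wordShape v) :
    Congr u v := by
  obtain ⟨h1, h2⟩ := Prod.ext_iff.1 h
  exact ⟨leftTree_eq_of_shape_eq hp h1, leftTree_eq_of_shape_eq
    ((List.reverse_perm u).trans (hp.trans (List.reverse_perm v).symm)) h2⟩

/-- Reversal exchanges the two factors, so the second component is the same statement on left trees
with the factors swapped. -/
theorem Congr.append {u u' v v' : List ℕ} (hu : Congr u u') (hv : Congr v v') :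
    Congr (u ++ v) (u' ++ v') := by
  refine ⟨leftTree_append_congr hu.1 hv.1, ?_⟩
  rw [List.reverse_append, List.reverse_append]
  exact leftTree_append_congr hv.2 hu.2

theorem Congr.filter_lt {u v : List ℕ} (h : Congr u v) (n : ℕ) :
    Congr (u.filter (· < n)) (v.filter (· < n)) := by
  refine ⟨?_, ?_⟩
  · rw [leftTree_filter_lt, leftTree_filter_lt, h.1]
  · rw [← List.filter_reverse, ← List.filter_reverse, leftTree_filter_lt, leftTree_filter_lt, h.2]

theorem Congr.filter_ge {u v : List ℕ} (h : Congr u v) (n : ℕ) :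
    Congr (u.filter (n ≤ ·)) (v.filter (n ≤ ·)) := by
  refine ⟨?_, ?_⟩
  · rw [leftTree_filter_ge, leftTree_filter_ge, h.1]
  · rw [← List.filter_reverse, ← List.filter_reverse, leftTree_filter_ge, leftTree_filter_ge, h.2]

theorem numNodes_wordShape (u : List ℕ) : (wordShape u).1.numNodes = u.length :=
  (numNodes_shape _).trans (numNodes_leftTree _)

theorem numNodes_pShape (σ : PermWord) : (pShape σ).1.numNodes = σ.1.length := by
  rw [pShape_eq, numNodes_wordShape]

theorem length_eq_of_pShape_eq {σ τ : PermWord} (h : pShape σ = pShape τ) :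
    σ.1.length = τ.1.length := by
  rw [← numNodes_pShape, h, numNodes_pShape]

theorem congr_of_pShape_eq {σ τ : PermWord} (h : pShape σ = pShape τ) : Congr σ.1 τ.1 := by
  refine congr_of_wordShape_eq (σ.2.trans ?_) (by rwa [← pShape_eq, ← pShape_eq])
  rw [length_eq_of_pShape_eq h]
  exact τ.2.symm

/-! ### Canopies -/

/-- The orientation of the leaf of a binary search tree that separates the labels smaller than `k`
from the other ones. -/
def gapOrient (k : ℕ) (o : Bool) : BinaryTree ℕ → Bool
  | .nil => o
  | .node b l r => if k ≤ b then gapOrient k true l else gapOrient k false r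

/-- The `n + 1` leaves sit in the gaps around the `n` consecutive labels, and the leaf just before
the value `k` is reached by searching for `k`. -/
theorem leafOrientations_eq_map (t : BinaryTree ℕ) (o : Bool) (s n : ℕ)
    (h : inorder t = List.range' s n) :
    leafOrientations o (shape t) = (List.range' s (n + 1)).map fun k => gapOrient k o t := by
  induction t generalizing o s n with
  | nil =>
    have : 0 = n := by simpa [inorder] using congrArg List.length h
    subst this
    rfl
  | node b l r hl hr =>
    rw [inorder] at h
    obtain ⟨m, hm⟩ : ∃ m, (inorder l).length = m := ⟨_, rfl⟩
    obtain ⟨p, hp⟩ : ∃ p, (inorder r).length = p := ⟨_, rfl⟩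
    have hn : n = m + (p + 1) := by
      have := congrArg List.length h
      simp only [List.length_append, List.length_cons, List.length_range'] at this
      omega
    subst hn
    rw [← List.range'_append_1, List.range'_succ] at h
    obtain ⟨h1, h2⟩ := List.append_inj h (by simp [hm])
    obtain ⟨rfl, h3⟩ := List.cons.inj h2
    rw [shape_node, leafOrientations, hl _ _ _ h1, hr _ _ _ h3,
      -- A subtree with `m` nodes has `m + 1` leaves, so the gaps split as `m + 1` on the left and
      -- `p + 1` on the right.
      show m + (p + 1) + 1 = (m + 1) + (p + 1) by omega,
      ← List.range'_append_1 (m := m + 1) (n := p + 1), List.map_append]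
    congr 1
    · refine List.map_congr_left fun k hk => ?_
      rw [List.mem_range'_1] at hk
      rw [gapOrient, if_pos (by omega)]
    · rw [show s + (m + 1) = s + m + 1 by omega]
      refine List.map_congr_left fun k hk => ?_
      rw [List.mem_range'_1] at hk
      rw [gapOrient, if_neg (by omega)]

/-- The search always goes right and ends at a right child. Only an empty tree returns `o` itself,
which is why `ho` excludes an empty tree with `o = true`. -/
theorem gapOrient_of_forall_lt {k : ℕ} {o : Bool} {t : BinaryTree ℕ}
    (h : ∀ b ∈ inorder t, b < k) (ho : o = true → inorder t ≠ []) : gapOrient k o t = false := by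
  induction t generalizing o with
  | nil => cases o <;> simp_all [gapOrient, inorder]
  | node b l r hl hr =>
    simp only [inorder, List.mem_append, List.mem_cons] at h
    rw [gapOrient, if_neg (h b (by simp)).not_ge]
    exact hr (fun c hc => h c (by simp [hc])) (by simp)

theorem gapOrient_of_forall_ge {k : ℕ} {o : Bool} {t : BinaryTree ℕ}
    (h : ∀ b ∈ inorder t, k ≤ b) (ho : o = false → inorder t ≠ []) : gapOrient k o t = true := by
  induction t generalizing o with
  | nil => cases o <;> simp_all [gapOrient, inorder]
  | node b l r hl hr =>
    simp only [inorder, List.mem_append, List.mem_cons] at h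
    rw [gapOrient, if_pos (h b (by simp))]
    exact hl (fun c hc => h c (by simp [hc])) (by simp)

/-- A root other than `k` and `k + 1` sends both letters and the gap between them to the same side.
Once the root is `k`, the search turns right into a nonempty tree of larger labels and ends at a
left leaf; once it is `k + 1`, it turns left and ends at a right leaf. So the leaf records which of
the two letters comes first. -/
theorem gapOrient_leftTree {k x y : ℕ} (hxy : x = k ∧ y = k + 1 ∨ x = k + 1 ∧ y = k) (o : Bool)
    {u : List ℕ} (h : u.filter (fun a => a = k ∨ a = k + 1) = [x, y]) :
    gapOrient (k + 1) o (leftTree u) = decide (x = k) := by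
  induction hn : u.length using Nat.strong_induction_on generalizing u o with
  | _ n ih =>
  cases u with
  | nil => simp at h
  | cons a u =>
    have hlen : ∀ p : ℕ → Bool, (u.filter p).length < n := fun p => by
      have := List.length_filter_le p u
      simp only [List.length_cons] at hn
      omega
    have mem : ∀ {p : ℕ → Bool} {x}, x ∈ inorder (leftTree (u.filter p)) → p x := fun hx =>
      (List.mem_filter.1 ((inorder_leftTree_perm _).mem_iff.1 hx)).2
    have hy : u.filter (fun a => a = k ∨ a = k + 1) = [y] → y ∈ u := fun h =>
      List.mem_of_mem_filter (h ▸ List.mem_singleton_self y)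
    have ne : ∀ {p : ℕ → Bool} {x}, x ∈ u → p x → inorder (leftTree (u.filter p)) ≠ [] :=
      fun hx hp => List.ne_nil_of_mem
        ((inorder_leftTree_perm _).mem_iff.2 (List.mem_filter.2 ⟨hx, hp⟩))
    rw [leftTree_cons, gapOrient]
    by_cases ha : a = k ∨ a = k + 1
    · rw [List.filter_cons_of_pos (by simpa using ha), List.cons.injEq] at h
      obtain ⟨rfl, h⟩ := h
      rcases hxy with ⟨rfl, rfl⟩ | ⟨rfl, rfl⟩
      · rw [if_neg (by omega), decide_eq_true rfl]
        refine gapOrient_of_forall_ge (fun b hb => ?_) fun _ => ne (hy h) (by simp)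
        obtain ⟨hbu, hb⟩ := List.mem_filter.1 ((inorder_leftTree_perm _).mem_iff.1 hb)
        have hb : a ≤ b := by simpa using hb
        have hne : b ≠ a := by
          rintro rfl
          have : b ∈ u.filter (fun c => c = b ∨ c = b + 1) := List.mem_filter.2 ⟨hbu, by simp⟩
          rw [h, List.mem_singleton] at this
          omega
        omega
      · rw [if_pos le_rfl, decide_eq_false (by omega)]
        refine gapOrient_of_forall_lt (fun b hb => ?_) fun _ => ne (hy h) (by simp)
        simpa using mem hb
    · rw [List.filter_cons_of_neg (by simpa using ha)] at h
      split_ifs with hk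
      · refine ih _ (hlen _) _ ?_ rfl
        rw [List.filter_filter, ← h]
        refine List.filter_congr fun b _ => ?_
        simp only [← Bool.decide_and, decide_eq_decide]
        omega
      · refine ih _ (hlen _) _ ?_ rfl
        rw [List.filter_filter, ← h]
        refine List.filter_congr fun b _ => ?_
        simp only [← Bool.decide_and, decide_eq_decide]
        omega

theorem inorder_leftTree_range {u : List ℕ} {n : ℕ} (h : u.Perm (List.range n)) :
    inorder (leftTree u) = List.range' 0 n := by
  refine ((inorder_leftTree_perm u).trans h).trans (by rw [List.range_eq_range'])
    |>.eq_of_pairwise (fun _ _ _ _ => le_antisymm) (inorder_leftTree_pairwise u) ?_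
  exact List.pairwise_le_range'

theorem canopy_leftTree {u : List ℕ} {n : ℕ} (h : u.Perm (List.range n)) :
    canopy (shape (leftTree u)) =
      (List.range' 1 (n - 1)).map fun k => gapOrient k true (leftTree u) := by
  rw [canopy, leafOrientations_eq_map _ _ _ _ (inorder_leftTree_range h), ← List.map_tail,
    ← List.map_dropLast, List.tail_range']
  -- For `n = 0` the single leaf is removed by `tail`, and `n - 1` truncates to 0.
  cases n with
  | zero => rfl
  | succ n => rw [Nat.add_sub_cancel, List.range'_concat, List.dropLast_concat]; rfl

theorem filter_eq_or {u : List ℕ} {n k : ℕ} (h : u.Perm (List.range n)) (hk : k + 1 < n) :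
    u.filter (fun a => a = k ∨ a = k + 1) = [k, k + 1] ∨
      u.filter (fun a => a = k ∨ a = k + 1) = [k + 1, k] := by
  have hp : (u.filter (fun a => a = k ∨ a = k + 1)).Perm [k, k + 1] := by
    refine (List.perm_ext_iff_of_nodup ((h.nodup_iff.2 List.nodup_range).filter _)
      (by simp)).2 fun a => ?_
    simp only [List.mem_filter, h.mem_iff, List.mem_range, decide_eq_true_eq, List.mem_cons,
      List.not_mem_nil, or_false]
    omega
  generalize u.filter (fun a => a = k ∨ a = k + 1) = w at hp
  match w, hp.length_eq with
  | [x, y], _ =>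
    have h1 : ∀ a, a = x ∨ a = y ↔ a = k ∨ a = k + 1 := fun a => by
      simpa using hp.mem_iff (a := a)
    have h2 : x ≠ y := by simpa using hp.nodup_iff.2 (by simp)
    have hx := (h1 x).1 (Or.inl rfl)
    have hy := (h1 y).1 (Or.inr rfl)
    simp only [List.cons.injEq, and_true]
    omega

/-- Each canopy letter says which of two consecutive values comes first in the word that is read.
The second tree reads the reversed word, so every letter flips. -/
theorem isTwin_pShape (σ : PermWord) : IsTwin (pShape σ) := by
  have hr : σ.1.reverse.Perm (List.range σ.1.length) := (List.reverse_perm _).trans σ.2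
  rw [pShape_eq]
  refine ⟨?_, ?_⟩
  · simp only [wordShape, numNodes_shape, numNodes_leftTree, List.length_reverse]
  · simp only [wordShape, canopy_leftTree σ.2, canopy_leftTree hr]
    rw [List.forall₂_map_left_iff, List.forall₂_map_right_iff, List.forall₂_same]
    intro k hk
    rw [List.mem_range'_1] at hk
    -- An inner gap `k` separates the values `k - 1` and `k`.
    obtain ⟨j, rfl⟩ : ∃ j, k = j + 1 := ⟨k - 1, by omega⟩
    rcases filter_eq_or σ.2 (k := j) (by omega) with h | h
    · have h2 : σ.1.reverse.filter (fun a => a = j ∨ a = j + 1) = [j + 1, j] := by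
        rw [List.filter_reverse, h]
        rfl
      rw [gapOrient_leftTree (by simp) _ h, gapOrient_leftTree (by simp) _ h2]
      simp
    · have h2 : σ.1.reverse.filter (fun a => a = j ∨ a = j + 1) = [j, j + 1] := by
        rw [List.filter_reverse, h]
        rfl
      rw [gapOrient_leftTree (by simp) _ h, gapOrient_leftTree (by simp) _ h2]
      simp

/-! ### Sums over Baxter classes -/

theorem mem_fiber {p : BinaryTree Unit × BinaryTree Unit} {σ : PermWord} :
    σ ∈ (finite_fiber p).toFinset ↔ pShape σ = p := by simp

/-- The pair of twin binary trees of a permutation. -/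
def twinShape (σ : PermWord) : TwinTrees := ⟨pShape σ, isTwin_pShape σ⟩

theorem P_mem_Baxter (K : Type*) [CommRing K] (J : TwinTrees) : P K J ∈ Baxter K :=
  Submodule.subset_span ⟨J, rfl⟩

/-- A finite set saturated for the P-symbol is a disjoint union of full fibres, each indexed by a
twin pair. -/
theorem sum_F_mem_Baxter (K : Type*) [CommRing K] {A : Finset PermWord}
    (hA : ∀ σ ∈ A, ∀ τ, pShape τ = pShape σ → τ ∈ A) :
    ∑ σ ∈ A, FQSym.F K σ ∈ Baxter K := by
  classical
  rw [← Finset.sum_fiberwise_of_maps_to (g := pShape) (t := A.image pShape)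
    fun σ hσ => Finset.mem_image_of_mem _ hσ]
  refine Submodule.sum_mem _ fun p hp => ?_
  obtain ⟨σ, hσ, rfl⟩ := Finset.mem_image.1 hp
  convert P_mem_Baxter K (twinShape σ) using 1
  refine Finset.sum_congr (Finset.ext fun τ => ?_) fun _ _ => rfl
  rw [Finset.mem_filter, mem_fiber]
  exact ⟨fun h => h.2, fun h => ⟨hA σ hσ τ h, h⟩⟩

theorem one_mem_Baxter (K : Type*) [CommRing K] : (1 : FQSym K) ∈ Baxter K := by
  have h := sum_F_mem_Baxter K (A := {PermWord.empty}) fun σ hσ τ h => by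
    rw [Finset.mem_singleton] at hσ ⊢
    subst hσ
    exact Subtype.ext (List.length_eq_zero_iff.1 (length_eq_of_pShape_eq h))
  rwa [Finset.sum_singleton] at h

/-! ### Products -/

section Shuffle

variable {α : Type*}

/-- Since `p` tells the letters of the two words apart, a shuffle is exactly a word with the two
prescribed restrictions. This form is the one to which the restriction lemmas for `Congr` apply. -/
theorem mem_shuffle_iff (p : α → Bool) {u v : List α} (hu : ∀ x ∈ u, p x)
    (hv : ∀ x ∈ v, ¬ p x) (w : List α) :
    w ∈ shuffle u v ↔ w.filter p = u ∧ w.filter (fun x => !p x) = v := by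
  induction w generalizing u v with
  | nil =>
    cases u with
    | nil => simp [shuffle_nil_left]
    | cons a u =>
      cases v with
      | nil => simp [shuffle_nil_right]
      | cons b v => simp [shuffle_cons_cons]
  | cons c w ih =>
    cases u with
    | nil =>
      rw [shuffle_nil_left, Multiset.mem_singleton]
      constructor
      · rintro rfl
        exact ⟨List.filter_eq_nil_iff.2 hv, List.filter_eq_self.2 fun x hx => by simpa using hv x hx⟩
      · rintro ⟨h1, h2⟩
        rw [← h2, eq_comm, List.filter_eq_self]
        exact fun x hx => by simpa using List.filter_eq_nil_iff.1 h1 x hx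
    | cons a u =>
      have hu' := List.forall_mem_cons.1 hu
      cases v with
      | nil =>
        rw [shuffle_nil_right, Multiset.mem_singleton]
        constructor
        · rintro h
          rw [h]
          exact ⟨List.filter_eq_self.2 hu, List.filter_eq_nil_iff.2 fun x hx => by simpa using hu x hx⟩
        · rintro ⟨h1, h2⟩
          rw [← h1, eq_comm, List.filter_eq_self]
          exact fun x hx => by simpa using List.filter_eq_nil_iff.1 h2 x hx
      | cons b v =>
        have hv' := List.forall_mem_cons.1 hv
        simp only [shuffle_cons_cons, Multiset.mem_add, Multiset.mem_map, List.cons.injEq,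
          existsAndEq, ih hu'.2 hv, ih hu hv'.2]
        by_cases hc : p c
        · have : b ≠ c := fun h => hv'.1 (h ▸ hc)
          simp only [List.filter_cons, hc, this]
          grind
        · have : a ≠ c := fun h => hc (h ▸ hu'.1)
          simp only [List.filter_cons, hc, this]
          grind

/-- The two summands of the recursion begin with different letters, so no shuffle occurs twice and
products of basis elements have coefficients 0 and 1. -/
theorem nodup_shuffle (p : α → Bool) {u v : List α} (hu : ∀ x ∈ u, p x)
    (hv : ∀ x ∈ v, ¬ p x) : (shuffle u v).Nodup := by
  induction u generalizing v with
  | nil => simp [shuffle_nil_left]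
  | cons a u ihu =>
    have hu' := List.forall_mem_cons.1 hu
    induction v with
    | nil => simp [shuffle_nil_right]
    | cons b v ihv =>
      have hv' := List.forall_mem_cons.1 hv
      rw [shuffle_cons_cons, Multiset.nodup_add]
      refine ⟨(ihu hu'.2 hv).map List.cons_injective, (ihv hv'.2).map List.cons_injective, ?_⟩
      rw [Multiset.disjoint_left]
      intro w h1 h2
      obtain ⟨x, -, rfl⟩ := Multiset.mem_map.1 h1
      obtain ⟨y, -, h⟩ := Multiset.mem_map.1 h2
      exact hv'.1 ((List.cons.inj h).1 ▸ hu'.1)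

end Shuffle

namespace PermWord

theorem lt_length (σ : PermWord) {x : ℕ} (hx : x ∈ σ.1) : x < σ.1.length :=
  List.mem_range.1 (σ.2.mem_iff.1 hx)

theorem not_lt_of_mem_shift (ν : PermWord) {n x : ℕ} (hx : x ∈ ν.1.map (· + n)) : ¬ x < n := by
  obtain ⟨y, -, rfl⟩ := List.mem_map.1 hx
  omega

theorem nodup_shiftedShuffle (σ ν : PermWord) : (shiftedShuffle σ ν).Nodup := by
  refine Multiset.Nodup.pmap (fun _ _ _ _ h => congrArg Subtype.val h) ?_
  exact nodup_shuffle (fun x => decide (x < σ.1.length)) (fun x hx => by simpa using lt_length σ hx)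
    fun x hx => by simpa using not_lt_of_mem_shift ν hx

theorem mem_shiftedShuffle {σ ν π : PermWord} : π ∈ shiftedShuffle σ ν ↔
    π.1.filter (· < σ.1.length) = σ.1 ∧
      π.1.filter (σ.1.length ≤ ·) = ν.1.map (· + σ.1.length) := by
  have h1 : π ∈ shiftedShuffle σ ν ↔ π.1 ∈ shuffle σ.1 (ν.1.map (· + σ.1.length)) := by
    rw [shiftedShuffle, Multiset.mem_pmap]
    exact ⟨by rintro ⟨w, hw, rfl⟩; exact hw, fun h => ⟨_, h, rfl⟩⟩
  rw [h1, mem_shuffle_iff (fun x => decide (x < σ.1.length))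
    (fun x hx => by simpa using lt_length σ hx)
    fun x hx => by simpa using not_lt_of_mem_shift ν hx]
  simp only [← decide_not, not_lt]

end PermWord

theorem wordShape_std (u : List ℕ) : wordShape (std u) = wordShape u := by
  rw [wordShape, shape_leftTree_std, shape_leftTree_reverse_std, wordShape]

theorem wordShape_shift (u : List ℕ) (n : ℕ) : wordShape (u.map (· + n)) = wordShape u := by
  rw [← wordShape_std, std_map fun x _ y _ h => Nat.add_lt_add_right h n, wordShape_std]

theorem F_mul_F (K : Type*) [CommRing K] [DecidableEq PermWord] (σ ν : PermWord) :
    FQSym.F K σ * FQSym.F K ν = ∑ π ∈ (PermWord.shiftedShuffle σ ν).toFinset, FQSym.F K π := by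
  rw [FQSym.mul_def, FQSym.mulMap, FQSym.extend_F, FQSym.extend_F, Finset.sum,
    Multiset.toFinset_val, (PermWord.nodup_shiftedShuffle σ ν).dedup]

/-- Saturation of the support of a product: `σ'` and `ν'` are the restrictions of `π'` to the values
below and above the size of `σ`, the latter shifted down. -/
theorem exists_mem_shiftedShuffle {σ ν π π' : PermWord} (h : π ∈ PermWord.shiftedShuffle σ ν)
    (hp : pShape π' = pShape π) : ∃ σ' ν' : PermWord, pShape σ' = pShape σ ∧
      pShape ν' = pShape ν ∧ π' ∈ PermWord.shiftedShuffle σ' ν' := by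
  obtain ⟨n, hn⟩ : ∃ n, σ.1.length = n := ⟨_, rfl⟩
  rw [PermWord.mem_shiftedShuffle, hn] at h
  have hc := congr_of_pShape_eq hp
  have hperm : π'.1.Perm π.1 := π'.2.trans (by rw [length_eq_of_pShape_eq hp]; exact π.2.symm)
  have h1 : (π'.1.filter (· < n)).Perm σ.1 := h.1 ▸ hperm.filter _
  have h2 : (π'.1.filter (n ≤ ·)).Perm (ν.1.map (· + n)) := h.2 ▸ hperm.filter _
  -- The truncated subtraction loses nothing, all letters here being at least `n`.
  have h3 : ((π'.1.filter (n ≤ ·)).map (· - n)).map (· + n) = π'.1.filter (n ≤ ·) := by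
    rw [List.map_map]
    conv_rhs => rw [← List.map_id (π'.1.filter (n ≤ ·))]
    refine List.map_congr_left fun x hx => Nat.sub_add_cancel ?_
    simpa using (List.mem_filter.1 hx).2
  have h4 : ((π'.1.filter (n ≤ ·)).map (· - n)).Perm ν.1 := by
    have := h2.map (· - n)
    simpa [List.map_map, Function.comp_def] using this
  have hs : ∀ {u : List ℕ} {τ : PermWord}, u.Perm τ.1 → u.Perm (List.range u.length) :=
    fun {u τ} h => h.trans (by rw [h.length_eq]; exact τ.2)
  refine ⟨⟨_, hs h1⟩, ⟨_, hs h4⟩, ?_, ?_, ?_⟩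
  · rw [pShape_eq, pShape_eq, ← h.1]
    exact (hc.filter_lt n).wordShape_eq
  · rw [pShape_eq, pShape_eq, ← wordShape_shift _ n, ← wordShape_shift ν.1 n, ← h.2]
    simp only [h3]
    exact (hc.filter_ge n).wordShape_eq
  · rw [PermWord.mem_shiftedShuffle]
    simp only [h1.length_eq, hn, h3, and_self]

/-- Different pairs of factors have disjoint shifted shuffles, because a shuffle determines both
factors by restriction. The whole product is thus the sum over one saturated set. -/
theorem P_mul_P_mem_Baxter (K : Type*) [CommRing K] (I J : TwinTrees) :
    P K I * P K J ∈ Baxter K := by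
  classical
  rw [P, P, Finset.sum_mul_sum, ← Finset.sum_product']
  simp only [F_mul_F]
  rw [← Finset.sum_biUnion]
  · refine sum_F_mem_Baxter K fun π hπ π' hp => ?_
    simp only [Finset.mem_biUnion, Finset.mem_product, mem_fiber, Multiset.mem_toFinset,
      Prod.exists] at hπ ⊢
    obtain ⟨σ, ν, ⟨hσ, hν⟩, h⟩ := hπ
    obtain ⟨σ', ν', h1, h2, h3⟩ := exists_mem_shiftedShuffle h hp
    exact ⟨σ', ν', ⟨h1.trans hσ, h2.trans hν⟩, h3⟩
  · rintro ⟨σ, ν⟩ h1 ⟨σ', ν'⟩ h2 hne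
    refine Finset.disjoint_left.2 fun π hπ hπ' => hne ?_
    simp only [Finset.coe_product, Set.mem_prod, Finset.mem_coe, mem_fiber] at h1 h2
    rw [Multiset.mem_toFinset, PermWord.mem_shiftedShuffle] at hπ hπ'
    -- All members of the first class have the same size, so both shuffles are cut at the same
    -- threshold.
    have hl := length_eq_of_pShape_eq (h1.1.trans h2.1.symm)
    rw [← hl] at hπ'
    have e1 : σ = σ' := Subtype.ext (hπ.1.symm.trans hπ'.1)
    have e2 : ν = ν' := Subtype.ext
      (List.map_injective_iff.2 (add_left_injective _) (hπ.2.symm.trans hπ'.2))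
    rw [e1, e2]

theorem mul_mem_Baxter {K : Type*} [CommRing K] {x y : FQSym K} (hx : x ∈ Baxter K)
    (hy : y ∈ Baxter K) : x * y ∈ Baxter K := by
  have h := Submodule.mul_mem_mul hx hy
  rw [Baxter, Submodule.span_mul_span] at h
  refine Submodule.span_le.2 ?_ h
  rintro _ ⟨_, ⟨I, rfl⟩, _, ⟨J, rfl⟩, rfl⟩
  exact P_mul_P_mem_Baxter K I J

/-! ### Coproducts -/

/-- Both words are standardized by the same rank function, which is injective on their common
letters. -/
theorem eq_of_perm_of_std_eq {u v : List ℕ} (h : u.Perm v) (hs : std u = std v) : u = v := by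
  have hc : std v = v.map fun x => u.countP (· < x) := by
    simp only [std, h.countP_eq]
  rw [hc, std] at hs
  have hinj : Set.InjOn (fun x => u.countP (· < x)) {x | x ∈ u} := by
    intro x hx y hy hxy
    have h1 := countP_lt_iff hx hy
    have h2 := countP_lt_iff hy hx
    dsimp only at hxy
    omega
  have hf := hinj.leftInvOn_invFunOn
  have hw : ∀ w : List ℕ, (∀ x ∈ w, x ∈ u) → (w.map fun x => u.countP (· < x)).map
      (Function.invFunOn (fun x => u.countP (· < x)) {x | x ∈ u}) = w := fun w hw => by
    rw [List.map_map]
    exact (List.map_congr_left fun x hx => hf (hw x hx)).trans (List.map_id w)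
  rw [← hw u fun _ => id, hs, hw v fun _ => h.mem_iff.2]

/-- Standardization can be inverted on a given letter set: replace each rank `k` in `α` by the
letter of `u` of rank `k`. -/
theorem exists_perm_std_eq {u : List ℕ} (hu : u.Nodup) (α : PermWord)
    (hα : α.1.length = u.length) : ∃ v : List ℕ, v.Perm u ∧ std v = α.1 := by
  have hp : (std u).Perm (List.range u.length) := by
    simpa [std] using std_perm hu
  -- Stated for all `k`, with 0 as a dummy value past the length, so that `choose` yields a total
  -- function on ranks.
  have hex : ∀ k, ∃ x, k < u.length → x ∈ u ∧ u.countP (· < x) = k := by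
    intro k
    by_cases hk : k < u.length
    · obtain ⟨x, hx⟩ := List.mem_map.1 (hp.mem_iff.2 (List.mem_range.2 hk))
      exact ⟨x, fun _ => hx⟩
    · exact ⟨0, fun h => absurd h hk⟩
  choose f hf using hex
  have hlt : ∀ x ∈ u, u.countP (· < x) < u.length := fun x hx =>
    List.mem_range.1 (hp.mem_iff.1 (List.mem_map_of_mem hx))
  have hid : (std u).map f = u := by
    conv_rhs => rw [← List.map_id u]
    rw [std, List.map_map]
    refine List.map_congr_left fun x hx => ?_
    obtain ⟨h1, h2⟩ := hf _ (hlt x hx)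
    have a1 := countP_lt_iff h1 hx
    have a2 := countP_lt_iff hx h1
    simp only [Function.comp_apply, id]
    omega
  have hv : (α.1.map f).Perm u := by
    have := ((hα ▸ α.2).trans hp.symm).map f
    rwa [hid] at this
  refine ⟨α.1.map f, hv, ?_⟩
  conv_rhs => rw [← List.map_id α.1]
  simp only [std, hv.countP_eq, List.map_map]
  refine List.map_congr_left fun k hk => ?_
  exact (hf k (hα ▸ α.lt_length hk)).2

theorem pShape_stdTake (i : ℕ) (σ : PermWord) :
    pShape (PermWord.stdTake i σ) = wordShape (σ.1.take i) := pShape_ofNodup _ _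

theorem pShape_stdDrop (i : ℕ) (σ : PermWord) :
    pShape (PermWord.stdDrop i σ) = wordShape (σ.1.drop i) := pShape_ofNodup _ _

/-- Replacing the two standardized factors of a permutation by congruent ones, while keeping the
letters of the factors, gives a congruent permutation. -/
theorem exists_stdTake_stdDrop {σ α β : PermWord} {i : ℕ} (hi : i ≤ σ.1.length)
    (hα : pShape α = pShape (PermWord.stdTake i σ))
    (hβ : pShape β = pShape (PermWord.stdDrop i σ)) :
    ∃ τ : PermWord, pShape τ = pShape σ ∧ (τ.1.take i).Perm (σ.1.take i) ∧
      PermWord.stdTake i τ = α ∧ PermWord.stdDrop i τ = β := by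
  have hnd := List.nodup_append.1 (List.take_append_drop i σ.1 ▸ σ.nodup)
  have lα : α.1.length = (σ.1.take i).length := by
    rw [length_eq_of_pShape_eq hα, PermWord.length_stdTake, List.length_take]
  have lβ : β.1.length = (σ.1.drop i).length := by
    rw [length_eq_of_pShape_eq hβ, PermWord.length_stdDrop, List.length_drop]
  -- Spell `α` and `β` with the letters of the prefix and of the suffix of `σ`; the concatenation `u
  -- ++ v` is the required permutation.
  obtain ⟨u, hu, su⟩ := exists_perm_std_eq hnd.1 α lα
  obtain ⟨v, hv, sv⟩ := exists_perm_std_eq hnd.2.1 β lβ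
  have hp : (u ++ v).Perm σ.1 := by
    have := hu.append hv
    rwa [List.take_append_drop] at this
  have hlen : u.length = i := by
    rw [hu.length_eq, List.length_take]
    omega
  have cu : Congr u (σ.1.take i) := congr_of_wordShape_eq hu (by
    rw [← wordShape_std, su, ← pShape_eq, hα, pShape_stdTake])
  have cv : Congr v (σ.1.drop i) := congr_of_wordShape_eq hv (by
    rw [← wordShape_std, sv, ← pShape_eq, hβ, pShape_stdDrop])
  have hc := cu.append cv
  rw [List.take_append_drop] at hc
  refine ⟨⟨u ++ v, hp.trans (by rw [hp.length_eq]; exact σ.2)⟩, ?_, ?_, Subtype.ext ?_,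
    Subtype.ext ?_⟩
  · rw [pShape_eq, pShape_eq, hc.wordShape_eq]
  · simpa only [List.take_left' hlen] using hu
  · simpa only [PermWord.stdTake, PermWord.ofNodup, List.take_left' hlen] using su
  · simpa only [PermWord.stdDrop, PermWord.ofNodup, List.drop_left' hlen] using sv

/-- The letters of the prefix determine those of the suffix, and each factor is recovered from its
letters and its standardization. -/
theorem eq_of_stdTake_of_stdDrop {σ τ : PermWord} {i : ℕ} (hl : σ.1.length = τ.1.length)
    (ht : (σ.1.take i).Perm (τ.1.take i)) (h1 : PermWord.stdTake i σ = PermWord.stdTake i τ)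
    (h2 : PermWord.stdDrop i σ = PermWord.stdDrop i τ) : σ = τ := by
  have e1 : σ.1.take i = τ.1.take i := eq_of_perm_of_std_eq ht (congrArg Subtype.val h1)
  have hp : σ.1.Perm τ.1 := σ.2.trans (by rw [hl]; exact τ.2.symm)
  rw [← List.take_append_drop i σ.1, ← List.take_append_drop i τ.1, e1,
    List.perm_append_left_iff] at hp
  have e2 : σ.1.drop i = τ.1.drop i := eq_of_perm_of_std_eq hp (congrArg Subtype.val h2)
  refine Subtype.ext ?_
  rw [← List.take_append_drop i σ.1, e1, e2, List.take_append_drop]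

/-- The heart of both the coproduct and the antipode: at a fixed cut position the class sum splits
into tensors of class sums. The size of the left factor is recorded for the induction in the
antipode. -/
theorem sum_stdTake_stdDrop_mem (K : Type*) [CommRing K] (J : TwinTrees) {i : ℕ}
    (hi : i ≤ J.1.1.numNodes) :
    ∑ σ ∈ (finite_fiber J.1).toFinset,
      FQSym.F K (PermWord.stdTake i σ) ⊗ₜ[K] FQSym.F K (PermWord.stdDrop i σ) ∈
    Submodule.span K {t : FQSym K ⊗[K] FQSym K |
      ∃ I L : TwinTrees, I.1.1.numNodes = i ∧ t = P K I ⊗ₜ[K] P K L} := by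
  classical
  -- The letter set of the prefix belongs to the key: without it several permutations could have the
  -- same pair of standardized factors, and the map to pairs would not be injective.
  let g : PermWord → Finset ℕ × (BinaryTree Unit × BinaryTree Unit) ×
      (BinaryTree Unit × BinaryTree Unit) := fun σ =>
    ((σ.1.take i).toFinset, pShape (PermWord.stdTake i σ), pShape (PermWord.stdDrop i σ))
  rw [← Finset.sum_fiberwise_of_maps_to (g := g) (t := (finite_fiber J.1).toFinset.image g)
    fun σ hσ => Finset.mem_image_of_mem _ hσ]
  refine Submodule.sum_mem _ fun p hp => Submodule.subset_span ?_
  obtain ⟨σ, hσ, rfl⟩ := Finset.mem_image.1 hp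
  rw [mem_fiber] at hσ
  have hi' : i ≤ σ.1.length := by rwa [← numNodes_pShape, hσ]
  refine ⟨twinShape (PermWord.stdTake i σ), twinShape (PermWord.stdDrop i σ), ?_, ?_⟩
  · rw [twinShape, numNodes_pShape, PermWord.length_stdTake]
    omega
  have hg : ∀ {τ τ' : PermWord}, g τ = g τ' → (τ.1.take i).Perm (τ'.1.take i) := fun {τ τ'} h =>
    List.perm_of_nodup_nodup_toFinset_eq (τ.nodup.sublist (List.take_sublist i _))
      (τ'.nodup.sublist (List.take_sublist i _)) (Prod.ext_iff.1 h).1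
  rw [P, P, TensorProduct.sum_tmul]
  simp only [TensorProduct.tmul_sum]
  rw [← Finset.sum_product']
  refine Finset.sum_bij (fun τ _ => (PermWord.stdTake i τ, PermWord.stdDrop i τ)) ?_ ?_ ?_ ?_
  · intro τ hτ
    have h := (Finset.mem_filter.1 hτ).2
    simp only [g, Prod.mk.injEq] at h
    exact Finset.mem_product.2 ⟨mem_fiber.2 h.2.1, mem_fiber.2 h.2.2⟩
  · intro τ hτ τ' hτ' h
    rw [Finset.mem_filter, mem_fiber] at hτ hτ'
    obtain ⟨h1, h2⟩ := Prod.ext_iff.1 h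
    exact eq_of_stdTake_of_stdDrop (length_eq_of_pShape_eq (hτ.1.trans hτ'.1.symm))
      (hg (hτ.2.trans hτ'.2.symm)) h1 h2
  -- Surjectivity uses compatibility with concatenation: the permutation rebuilt from `α` and `β`
  -- stays in the class `J`.
  · rintro ⟨α, β⟩ h
    rw [Finset.mem_product, mem_fiber, mem_fiber] at h
    obtain ⟨τ, h1, h2, h3, h4⟩ := exists_stdTake_stdDrop hi' h.1 h.2
    refine ⟨τ, Finset.mem_filter.2 ⟨mem_fiber.2 (h1.trans hσ), ?_⟩, by rw [h3, h4]⟩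
    simp only [g, Prod.mk.injEq, h3, h4]
    exact ⟨List.toFinset_eq_of_perm _ _ h2, h.1, h.2⟩
  · exact fun _ _ => rfl

theorem length_of_mem_fiber {J : TwinTrees} {σ : PermWord}
    (h : σ ∈ (finite_fiber J.1).toFinset) : σ.1.length = J.1.1.numNodes := by
  rw [← numNodes_pShape, mem_fiber.1 h]

theorem comul_P_mem (K : Type*) [CommRing K] (J : TwinTrees) :
    Coalgebra.comul (R := K) (P K J) ∈
      LinearMap.range (TensorProduct.map (Baxter K).subtype (Baxter K).subtype) := by
  have h : Coalgebra.comul (R := K) (P K J) = ∑ i ∈ Finset.range (J.1.1.numNodes + 1),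
      ∑ σ ∈ (finite_fiber J.1).toFinset,
        FQSym.F K (PermWord.stdTake i σ) ⊗ₜ[K] FQSym.F K (PermWord.stdDrop i σ) := by
    rw [Finset.sum_comm, P, map_sum]
    refine Finset.sum_congr rfl fun σ hσ => ?_
    rw [FQSym.comul_F, length_of_mem_fiber hσ]
  rw [h]
  refine Submodule.sum_mem _ fun i hi => ?_
  refine Submodule.span_le.2 ?_ (sum_stdTake_stdDrop_mem K J
    (Nat.lt_succ_iff.1 (Finset.mem_range.1 hi)))
  rintro _ ⟨I, L, -, rfl⟩
  exact ⟨⟨_, P_mem_Baxter K I⟩ ⊗ₜ[K] ⟨_, P_mem_Baxter K L⟩, TensorProduct.map_tmul _ _ _ _⟩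

/-! ### The antipode -/

/-- The recursion for the antipode only involves cuts with a nonempty suffix. Summed over a class,
it becomes a combination of products of the antipode of some `P K I`, with `I` strictly smaller, and
some `P K L`; induction and closure under products conclude. -/
theorem antipodeMap_P_mem (K : Type*) [CommRing K] (J : TwinTrees) :
    FQSym.antipodeMap K (P K J) ∈ Baxter K := by
  induction hn : J.1.1.numNodes using Nat.strong_induction_on generalizing J with
  | _ n ih =>
  rcases Nat.eq_zero_or_pos n with rfl | hpos
  · rw [P, map_sum]
    refine Submodule.sum_mem _ fun σ hσ => ?_
    have h0 : σ.1 = [] := List.length_eq_zero_iff.1 ((length_of_mem_fiber hσ).trans hn)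
    rw [FQSym.antipodeMap, FQSym.extend_F, FQSym.antipodeF_eq, if_pos h0]
    exact one_mem_Baxter K
  · have h : FQSym.antipodeMap K (P K J) = -∑ i ∈ Finset.range n,
        (LinearMap.mul' K (FQSym K) ∘ₗ (FQSym.antipodeMap K).rTensor (FQSym K))
          (∑ σ ∈ (finite_fiber J.1).toFinset,
            FQSym.F K (PermWord.stdTake i σ) ⊗ₜ[K] FQSym.F K (PermWord.stdDrop i σ)) := by
      simp only [map_sum, LinearMap.comp_apply, LinearMap.rTensor_tmul, LinearMap.mul'_apply]
      rw [Finset.sum_comm, ← Finset.sum_neg_distrib, P, map_sum]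
      refine Finset.sum_congr rfl fun σ hσ => ?_
      have hl := (length_of_mem_fiber hσ).trans hn
      have h0 : σ.1 ≠ [] := fun h => by simp [h] at hl; omega
      simp only [FQSym.antipodeMap, FQSym.extend_F]
      rw [FQSym.antipodeF_eq, if_neg h0, ← hl, Finset.sum_range]
    rw [h]
    refine Submodule.neg_mem _ (Submodule.sum_mem _ fun i hi => ?_)
    rw [Finset.mem_range] at hi
    -- Seen in the preimage of `Baxter K`, the claim need only be checked on the spanning tensors `P
    -- K I ⊗ₜ P K L`.
    rw [← Submodule.mem_comap]
    refine Submodule.span_le.2 ?_ (sum_stdTake_stdDrop_mem K J (hn ▸ hi.le))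
    rintro _ ⟨I, L, hI, rfl⟩
    exact mul_mem_Baxter (ih i hi I hI) (P_mem_Baxter K L)

/-- The span of the elements `P_J` is a Hopf subalgebra, over any commutative ring. -/
theorem isHopfSubalgebra_Baxter (K : Type*) [CommRing K] : IsHopfSubalgebra K (Baxter K) where
  one_mem := one_mem_Baxter K
  mul_mem _ hx _ hy := mul_mem_Baxter hx hy
  comul_mem _ hx := by
    rw [← Submodule.mem_comap]
    refine Submodule.span_le.2 ?_ hx
    rintro _ ⟨J, rfl⟩
    exact comul_P_mem K J
  antipode_mem _ hx := by
    rw [← Submodule.mem_comap]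
    refine Submodule.span_le.2 ?_ hx
    rintro _ ⟨J, rfl⟩
    exact antipodeMap_P_mem K J

end BaxterHopf

theorem mainTheorem8 (K : Type*) [Field K] [CharZero K] :
    BaxterHopf.IsHopfSubalgebra K (BaxterHopf.Baxter K) := by
  exact BaxterHopf.isHopfSubalgebra_Baxter K
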